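/- Let $\mathrm{pr}\colon\mathbf R^2\to T^2=(\mathbf R/2\pi\mathbf Z)^2$ be the standard projection, let $E$ be a smooth oriented real vector bundle of rank $4$ over $T^2$ with a positive-definite metric $h$, and let $\nabla$ be a connection of $E$ with $\nabla h=0$. For $\varepsilon\in\{+,-\}$ let $\bigwedge^2_\varepsilon E$ be the oriented rank $3$ subbundle of $\bigwedge^2E$ with the positive local orthonormal frames $\frac1{\sqrt2}(e_1\wedge e_2+\varepsilon e_3\wedge e_4)$, $\frac1{\sqrt2}(e_1\wedge e_3+\varepsilon e_4\wedge e_2)$, $\frac1{\sqrt2}(e_1\wedge e_4+\varepsilon e_2\wedge e_3)$, where $(e_1,e_2,e_3,e_4)$ are the positive local orthonormal frames of $E$; let $\hat E_\varepsilon$ be its unit sphere bundle, and let $\hat\nabla$ be the connection of $\bigwedge^2E$ induced by $\nabla$. *Topological holonomy group.* Let $(\omega_1,\omega_2,\omega_3)$ be a positive orthonormal basis of the fibre of $\bigwedge^2_\varepsilon E$ at $\mathrm{pr}(0,0)$, and let $\Omega_{i,x}$, $\Omega_{i,y}$ be the $\hat\nabla$-horizontal sections of $\hat E_\varepsilon$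 along the axes $x\mapsto\mathrm{pr}(x,0)$, $y\mapsto\mathrm{pr}(0,y)$ with value $\omega_i$ at $0$. There are $C_{\varepsilon,1},C_{\varepsilon,2}\in SO(3)$ with $(\Omega_{i,x}(a+2\pi))_i=(\Omega_{i,x}(a))_i\,C_{\varepsilon,1}$ and $(\Omega_{i,y}(b+2\pi))_i=(\Omega_{i,y}(b))_i\,C_{\varepsilon,2}$ for all $a,b\in\mathbf R$. The topological holonomy group $G_{\hat\nabla,\varepsilon}$ is the subgroup of $SO(3)$ generated by $C_{\varepsilon,1}$, $C_{\varepsilon,2}$; it is determined up to conjugation in $SO(3)$. *Complexity.* A normal polygonal curve is an oriented polygonal curve in $\mathbf R^2$ from $(0,0)$, each of whose line segments lies in a horizontal or vertical line and has end points with the same image under $\mathrm{pr}$. For $\omega$ in the fibre of $\hat E_\varepsilon$ at $\mathrm{pr}(0,0)$, let $X(\omega)$ be the set of all elements obtained from $\omega$ by $\hat\nabla$-parallel transport along normal polygonal curves. The horizontality in $\hat E_\varepsilon$ has infinite complexity if $X(\omega)$ is infinite for some such $\omega$. *The group $G$.* Let $G_0$ be a finite non-cyclic subgroup of $SO(3)$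 generated by two elements $C_1,C_2$, let $\theta_1,\theta_2\in(0,2\pi)$ be angles of rotation by $C_1,C_2$, and let $\phi\in(0,\pi/2]$ be the angle between the eigendirections of $C_1,C_2$ corresponding to the eigenvalue $1$. Let $(\theta_1',\theta_2')$ be $(\theta_1/2,\theta_2)$ or $(\theta_1,\theta_2/2)$, let $C_1',C_2'\in SO(3)$ be rotations with angles of rotation $\theta_1',\theta_2'$ such that $\phi$ is the angle between their eigendirections corresponding to the eigenvalue $1$, and let $G$ be the subgroup of $SO(3)$ generated by $C_1',C_2'$. **Proposition.** Suppose that $G_{\hat\nabla,\varepsilon}$ is isomorphic to such a group $G$ and that the horizontality in $\hat E_\varepsilon$ with respect to $\hat\nabla$ has infinite complexity. Then $G_{\hat\nabla,\varepsilon}$ contains two elements $\hat C_1,\hat C_2$ such that - (A) $\hat C_k^2$ is not the identity matrix, for $k=1$ and for $k=2$; - (B) an eigenvector of $\hat C_1$ and an eigenvector of $\hat C_2$, both corresponding to the eigenvalue $1$, are linearly independent; - (C) for $k=1$ or $k=2$, an eigenvalue of $\hat C_k$ other than $1$ is $\exp(\sqrt{-1}\,\psi\pi)$ for an irrational real number $\psi$.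 -/

import Mathlib

open Bundle Filter Set
open scoped Manifold ContDiff Topology

noncomputable section

namespace TopHolonomy

/-! ### The torus -/

/-- The torus `T² = S¹ × S¹`; the circle `ℝ / 2πℤ` is the unit circle through `t ↦ exp (i t)`. -/
abbrev Torus : Type := Circle × Circle

/-- The model with corners of the smooth surface `T²`. -/
abbrev torusModel :
    ModelWithCorners ℝ (EuclideanSpace ℝ (Fin 1) × EuclideanSpace ℝ (Fin 1))
      (ModelProd (EuclideanSpace ℝ (Fin 1)) (EuclideanSpace ℝ (Fin 1))) :=
  (𝓡 1).prod (𝓡 1)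

/-- The model fibre of a real vector bundle of rank 4. -/
abbrev R4 : Type := EuclideanSpace ℝ (Fin 4)

/-- The standard projection `pr : ℝ² → T²`. -/
def pr (p : ℝ × ℝ) : Torus := (Circle.exp p.1, Circle.exp p.2)

/-- The image in `T²` of the horizontal axis `{(t, 0)}`. -/
def lineX (t : ℝ) : Torus := pr (t, 0)

/-- The image in `T²` of the vertical axis `{(0, t)}`. -/
def lineY (t : ℝ) : Torus := pr (0, t)

/-- The image in `T²` of the line segment from `v` to `w`, run through for `t ∈ [0, 1]`. -/
def segmentCurve (v w : ℝ × ℝ) (t : ℝ) : Torus := pr (v + t • (w - v))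

/-- The velocity vector of a curve in `T²`. -/
def velocity (c : ℝ → Torus) (t : ℝ) : TangentSpace torusModel (c t) :=
  mfderiv 𝓘(ℝ, ℝ) torusModel c t (1 : ℝ)

/-! ### 2-vectors of a Euclidean vector space of dimension 4 -/

section Fibre

variable {W : Type*} [NormedAddCommGroup W] [InnerProductSpace ℝ W]

/-- The 2-vector `u ∧ v`. -/
def wedge (u v : W) : ⋀[ℝ]^2 W := exteriorPower.ιMulti ℝ 2 ![u, v]

/-- The metric `ĥ` on 2-vectors induced by the inner product:
`ĥ (u ∧ v) (u' ∧ v') = ⟨u, u'⟩ ⟨v, v'⟩ - ⟨u, v'⟩ ⟨v, u'⟩`, see `hatMetric_wedge`. -/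
def hatMetric : ⋀[ℝ]^2 W →ₗ[ℝ] ⋀[ℝ]^2 W →ₗ[ℝ] ℝ :=
  exteriorPower.pairingDual ℝ W 2 ∘ₗ exteriorPower.map 2 (innerₗ W)

theorem hatMetric_wedge (u v u' v' : W) :
    hatMetric (wedge u v) (wedge u' v') =
      inner ℝ u u' * inner ℝ v v' - inner ℝ u v' * inner ℝ v u' := by
  have h : exteriorPower.map 2 (innerₗ W) (exteriorPower.ιMulti ℝ 2 ![u, v]) =
      exteriorPower.ιMulti ℝ 2 (innerₗ W ∘ ![u, v]) :=
    exteriorPower.map_apply_ιMulti _ _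
  simp only [hatMetric, wedge, LinearMap.comp_apply, h,
    exteriorPower.pairingDual_ιMulti_ιMulti]
  simp [Matrix.det_fin_two]
  ring

/-- The triple `(Ω_{ε,1}, Ω_{ε,2}, Ω_{ε,3})` of 2-vectors given by an orthonormal basis
`(e₁, e₂, e₃, e₄)` and a sign `ε`. -/
def stdTriple (ε : ℤˣ) (e : OrthonormalBasis (Fin 4) ℝ W) : Fin 3 → ⋀[ℝ]^2 W :=
  ![(1 / √2 : ℝ) • (wedge (e 0) (e 1) + ε • wedge (e 2) (e 3)),
    (1 / √2 : ℝ) • (wedge (e 0) (e 2) + ε • wedge (e 3) (e 1)),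
    (1 / √2 : ℝ) • (wedge (e 0) (e 3) + ε • wedge (e 1) (e 2))]

/-- The subspace `⋀²_ε W` of an oriented Euclidean space `W` of dimension 4. -/
def halfTwoVectors (o : Orientation ℝ W (Fin 4)) (ε : ℤˣ) : Submodule ℝ (⋀[ℝ]^2 W) :=
  Submodule.span ℝ {α | ∃ e : OrthonormalBasis (Fin 4) ℝ W,
    e.toBasis.orientation = o ∧ ∃ i, α = stdTriple ε e i}

/-- The fibre of the twistor space: the unit sphere of `⋀²_ε W`. -/
def twistorFibre (o : Orientation ℝ W (Fin 4)) (ε : ℤˣ) : Set (⋀[ℝ]^2 W) :=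
  {α | α ∈ halfTwoVectors o ε ∧ hatMetric α α = 1}

/-- `α` is an orthonormal basis of `⋀²_ε W` which is positive for the orientation of `⋀²_ε W`
given by the triples `stdTriple ε e`, where `e` is a positive orthonormal basis of `W`. -/
def IsPositiveFrame (o : Orientation ℝ W (Fin 4)) (ε : ℤˣ) (α : Fin 3 → ⋀[ℝ]^2 W) : Prop :=
  (∀ i j, hatMetric (α i) (α j) = if i = j then 1 else 0) ∧
  ∃ e : OrthonormalBasis (Fin 4) ℝ W, e.toBasis.orientation = o ∧
    ∃ P : Matrix (Fin 3) (Fin 3) ℝ, 0 < P.det ∧ ∀ j, α j = ∑ i, P i j • stdTriple ε e i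

end Fibre

/-! ### Horizontal sections of the twistor space -/

section Bundle

variable {E : Torus → Type*} [TopologicalSpace (TotalSpace R4 E)]
  [∀ x, NormedAddCommGroup (E x)] [∀ x, InnerProductSpace ℝ (E x)] [FiberBundle R4 E]

/-- The section `σ` of the bundle `E` is smooth. -/
def IsSmoothSection (σ : ∀ x, E x) : Prop :=
  ContMDiff torusModel (torusModel.prod 𝓘(ℝ, R4)) ∞ (fun x ↦ TotalSpace.mk' R4 x (σ x))

/-- The family `o` of orientations of the fibres is an orientation of the bundle `E`: four smooth
sections which form a positive basis at a point do so at all nearby points. -/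
def IsBundleOrientation (o : ∀ x, Orientation ℝ (E x) (Fin 4)) : Prop :=
  ∀ σ : Fin 4 → ∀ x, E x, (∀ i, IsSmoothSection (σ i)) →
    IsOpen {x | ∃ b : Module.Basis (Fin 4) ℝ (E x), (∀ i, b i = σ i x) ∧ b.orientation = o x}

/-- `D` is the covariant derivative at time `t`, with respect to the connection `∇̂` of `⋀² E`
induced by `∇`, of the section `Ω` of `⋀² E` along the curve `c`, restricted to times in `s`.
Near `t`, one writes `Ω = ∑ fᵢ (ξᵢ ∧ ηᵢ)` with smooth sections `ξᵢ`, `ηᵢ` of `E` and coefficients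
`fᵢ` that depend on time, and then
`D = ∑ (fᵢ' (ξᵢ ∧ ηᵢ) + fᵢ (∇ ξᵢ ∧ ηᵢ + ξᵢ ∧ ∇ ηᵢ))`, with `∇` taken along the velocity of `c`. -/
def HasCovDerivWithinAt (cov : CovariantDerivative torusModel R4 E) (c : ℝ → Torus)
    (Ω : ∀ t, ⋀[ℝ]^2 (E (c t))) (s : Set ℝ) (t : ℝ) (D : ⋀[ℝ]^2 (E (c t))) : Prop :=
  ∃ (n : ℕ) (f : Fin n → ℝ → ℝ) (f' : Fin n → ℝ) (ξ η : Fin n → ∀ x, E x),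
    (∀ i, IsSmoothSection (ξ i) ∧ IsSmoothSection (η i)) ∧
    (∀ i, HasDerivWithinAt (f i) (f' i) s t) ∧
    (∀ᶠ τ in 𝓝[s] t, Ω τ = ∑ i, f i τ • wedge (ξ i (c τ)) (η i (c τ))) ∧
    D = ∑ i, (f' i • wedge (ξ i (c t)) (η i (c t)) +
      f i t • (wedge (cov (ξ i) (c t) (velocity c t)) (η i (c t)) +
        wedge (ξ i (c t)) (cov (η i) (c t) (velocity c t))))

/-- `Ω` is a section of the twistor space `Ê_ε` along `c` over the times in `s`, and it is
horizontal with respect to `∇̂`. -/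
def IsHorizontalOn (cov : CovariantDerivative torusModel R4 E)
    (o : ∀ x, Orientation ℝ (E x) (Fin 4)) (ε : ℤˣ) (c : ℝ → Torus)
    (Ω : ∀ t, ⋀[ℝ]^2 (E (c t))) (s : Set ℝ) : Prop :=
  ∀ t ∈ s, Ω t ∈ twistorFibre (o (c t)) ε ∧ HasCovDerivWithinAt cov c Ω s t 0

/-! ### Normal polygonal curves and the complexity of horizontality -/

/-- A normal polygonal curve in `ℝ²` from `(0, 0)`, given by its successive vertices: each of its
line segments lies in a coordinate line, and its end points have the same image in `T²`. -/
structure NormalPolygonalCurve where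
  length : ℕ
  vertex : Fin (length + 1) → ℝ × ℝ
  start : vertex 0 = (0, 0)
  coord : ∀ i : Fin length, (vertex i.castSucc).1 = (vertex i.succ).1 ∨
    (vertex i.castSucc).2 = (vertex i.succ).2
  closed : ∀ i : Fin length, pr (vertex i.castSucc) = pr (vertex i.succ)

/-- The parallel transport with respect to `∇̂` along the line segment from `v` to `w` takes the
element `p` of the total space of `⋀² E` to `q`. -/
def SegmentTransport (cov : CovariantDerivative torusModel R4 E)
    (o : ∀ x, Orientation ℝ (E x) (Fin 4)) (ε : ℤˣ) (v w : ℝ × ℝ)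
    (p q : Σ x, ⋀[ℝ]^2 (E x)) : Prop :=
  ∃ Ω : ∀ t, ⋀[ℝ]^2 (E (segmentCurve v w t)),
    IsHorizontalOn cov o ε (segmentCurve v w) Ω (Icc 0 1) ∧
    p = ⟨segmentCurve v w 0, Ω 0⟩ ∧ q = ⟨segmentCurve v w 1, Ω 1⟩

/-- `α' = α_γ`: the parallel transport along `γ` takes `α` to `α'`. -/
def CurveTransport (cov : CovariantDerivative torusModel R4 E)
    (o : ∀ x, Orientation ℝ (E x) (Fin 4)) (ε : ℤˣ) (γ : NormalPolygonalCurve)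
    (α α' : ⋀[ℝ]^2 (E (pr (0, 0)))) : Prop :=
  ∃ τ : Fin (γ.length + 1) → Σ x, ⋀[ℝ]^2 (E x),
    τ 0 = ⟨pr (0, 0), α⟩ ∧ τ (Fin.last γ.length) = ⟨pr (0, 0), α'⟩ ∧
    ∀ i : Fin γ.length, SegmentTransport cov o ε (γ.vertex i.castSucc) (γ.vertex i.succ)
      (τ i.castSucc) (τ i.succ)

/-- The set `X(α) = {α_γ | γ a normal polygonal curve}`. -/
def transportSet (cov : CovariantDerivative torusModel R4 E)
    (o : ∀ x, Orientation ℝ (E x) (Fin 4)) (ε : ℤˣ) (α : ⋀[ℝ]^2 (E (pr (0, 0)))) :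
    Set (⋀[ℝ]^2 (E (pr (0, 0)))) :=
  {α' | ∃ γ : NormalPolygonalCurve, CurveTransport cov o ε γ α α'}

/-- The horizontality in `Ê_ε` with respect to `∇̂` has infinite complexity (for some element of
the fibre of `Ê_ε` on `pr (0, 0)`). -/
def HasInfiniteComplexity (cov : CovariantDerivative torusModel R4 E)
    (o : ∀ x, Orientation ℝ (E x) (Fin 4)) (ε : ℤˣ) : Prop :=
  ∃ α ∈ twistorFibre (o (pr (0, 0))) ε, (transportSet cov o ε α).Infinite

/-! ### The topological holonomy group -/

/-- The group `SO(3)`. -/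
abbrev SO3 : Type := Matrix.specialOrthogonalGroup (Fin 3) ℝ

/-- `C` is the matrix with `(Ω₁(a + 2π) Ω₂(a + 2π) Ω₃(a + 2π)) = (Ω₁(a) Ω₂(a) Ω₃(a)) C` for all
`a`, for a frame along the `2π`-periodic curve `c`; the equality is one in the total space. -/
def IsMonodromyMatrix (c : ℝ → Torus) (Ω : Fin 3 → ∀ t, ⋀[ℝ]^2 (E (c t))) (C : SO3) : Prop :=
  ∀ (a : ℝ) (i : Fin 3),
    (⟨c (a + 2 * Real.pi), Ω i (a + 2 * Real.pi)⟩ : Σ x, ⋀[ℝ]^2 (E x)) =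
      ⟨c a, ∑ j, (C : Matrix (Fin 3) (Fin 3) ℝ) j i • Ω j a⟩

/-- `H` is the topological holonomy group `G_{∇̂,ε}` of `∇̂` in `⋀²_ε E` at `pr (0, 0)`. It depends
on the choice of a positive orthonormal basis `α` of the fibre of `⋀²_ε E`, so it is determined up
to conjugation in `SO(3)`. -/
def IsTopologicalHolonomyGroup (cov : CovariantDerivative torusModel R4 E)
    (o : ∀ x, Orientation ℝ (E x) (Fin 4)) (ε : ℤˣ) (H : Subgroup SO3) : Prop :=
  ∃ (α : Fin 3 → ⋀[ℝ]^2 (E (pr (0, 0))))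
    (Ωx : Fin 3 → ∀ t, ⋀[ℝ]^2 (E (lineX t))) (Ωy : Fin 3 → ∀ t, ⋀[ℝ]^2 (E (lineY t)))
    (C₁ C₂ : SO3),
    IsPositiveFrame (o (pr (0, 0))) ε α ∧
    (∀ i, IsHorizontalOn cov o ε lineX (Ωx i) univ ∧ Ωx i 0 = α i) ∧
    (∀ i, IsHorizontalOn cov o ε lineY (Ωy i) univ ∧ Ωy i 0 = α i) ∧
    IsMonodromyMatrix lineX Ωx C₁ ∧ IsMonodromyMatrix lineY Ωy C₂ ∧
    H = Subgroup.closure {C₁, C₂}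

end Bundle

/-! ### Rotations -/

/-- The rotation matrix `C(θ)` about the first coordinate axis. -/
def rotMatrix (θ : ℝ) : Matrix (Fin 3) (Fin 3) ℝ :=
  !![1, 0, 0; 0, Real.cos θ, -Real.sin θ; 0, Real.sin θ, Real.cos θ]

/-- `θ` is an angle of rotation by `C`. -/
def IsRotationAngle (C : SO3) (θ : ℝ) : Prop :=
  ∃ V : SO3, (C : Matrix (Fin 3) (Fin 3) ℝ) =
    (V : Matrix (Fin 3) (Fin 3) ℝ) * rotMatrix θ * (V : Matrix (Fin 3) (Fin 3) ℝ).transpose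

/-- `u` is an eigenvector of `C` corresponding to the eigenvalue `1`. -/
def IsAxisVector (C : SO3) (u : EuclideanSpace ℝ (Fin 3)) : Prop :=
  Module.End.HasEigenvector (Matrix.toEuclideanLin (C : Matrix (Fin 3) (Fin 3) ℝ)) 1 u

/-- `φ ∈ (0, π/2]` is the angle between the eigendirections of `C₁`, `C₂` corresponding to the
eigenvalue `1`. -/
def IsAxisAngle (C₁ C₂ : SO3) (φ : ℝ) : Prop :=
  φ ∈ Ioc 0 (Real.pi / 2) ∧
    ∃ u v, IsAxisVector C₁ u ∧ IsAxisVector C₂ v ∧ InnerProductGeometry.angle u v = φ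

/-- `G` is generated by two rotations `C₁'`, `C₂'` which are obtained from two generators `C₁`, `C₂`
of a finite non-cyclic subgroup `G₀` of `SO(3)` by halving one of the angles of rotation and keeping
the other one and the angle between the axes. -/
def IsHalvedAngleGroup (G : Subgroup SO3) : Prop :=
  ∃ (G₀ : Subgroup SO3) (C₁ C₂ C₁' C₂' : SO3) (θ₁ θ₂ θ₁' θ₂' φ : ℝ),
    Finite G₀ ∧ ¬ IsCyclic G₀ ∧ G₀ = Subgroup.closure {C₁, C₂} ∧
    θ₁ ∈ Ioo 0 (2 * Real.pi) ∧ θ₂ ∈ Ioo 0 (2 * Real.pi) ∧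
    IsRotationAngle C₁ θ₁ ∧ IsRotationAngle C₂ θ₂ ∧ IsAxisAngle C₁ C₂ φ ∧
    ((θ₁' = θ₁ / 2 ∧ θ₂' = θ₂) ∨ (θ₁' = θ₁ ∧ θ₂' = θ₂ / 2)) ∧
    IsRotationAngle C₁' θ₁' ∧ IsRotationAngle C₂' θ₂' ∧ IsAxisAngle C₁' C₂' φ ∧
    G = Subgroup.closure {C₁', C₂'}

/-- Condition (A): neither square is the identity matrix. -/
def ConditionA (C : Fin 2 → SO3) : Prop := ∀ k, C k ^ 2 ≠ 1

/-- Condition (B): eigenvectors of the two rotations corresponding to the eigenvalue `1` are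
linearly independent. (Every element of `SO(3)` has such eigenvectors; under condition (A) each of
the two eigenspaces is a line, so that the choice of the eigenvectors does not matter.) -/
def ConditionB (C : Fin 2 → SO3) : Prop :=
  ∀ u v, IsAxisVector (C 0) u → IsAxisVector (C 1) v → LinearIndependent ℝ ![u, v]

/-- Condition (C): for one of the two rotations, an eigenvalue other than `1` is `exp (i ψ π)` for
an irrational real number `ψ`. -/
def ConditionC (C : Fin 2 → SO3) : Prop :=
  ∃ (k : Fin 2) (ζ : ℂ) (ψ : ℝ),
    Module.End.HasEigenvalue
      (Matrix.toLin' ((C k : Matrix (Fin 3) (Fin 3) ℝ).map (algebraMap ℝ ℂ))) ζ ∧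
    ζ ≠ 1 ∧ Irrational ψ ∧ ζ = Complex.exp (Complex.I * ψ * Real.pi)

end TopHolonomy

end

/-!
Infinite complexity makes the topological holonomy group `H` infinite: parallel transport of a
metric connection is isometric, hence is given in a horizontal orthonormal frame by constant
coordinates, so that a normal polygonal curve acts on `ω` through a product of powers of `C₁` and
`C₂`. As a finitely generated infinite linear group, `H` contains an element `g` of infinite order
by the Burnside–Schur theorem. Let `ℓ` be the axis of `g`.

If some `h ∈ H` moves `ℓ`, then `g` and `h * g * h⁻¹` have the required properties. Otherwise `H`
preserves `ℓ`, so that the squares in `H` are rotations about `ℓ` and commute. This passes to the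
isomorphic group `G`, where it forces `G` to preserve the axis of the image `k` of `g`, since the
square of `k` commutes with the squares of the conjugates of `k`. The generators `A`, `B` of `G`
have finite order and no common axis, and one of them, say `A`, is not a half-turn. Hence `A` is a
rotation about the preserved line and `B` is a half-turn reversing it, and `G` is a finite dihedral
group, contrary to the infinite order of `k`.
-/

noncomputable section

namespace TopHolonomy

open scoped Matrix

/-! ### The Burnside–Schur theorem -/

section BurnsideSchur

instance isJacobsonRing_int : IsJacobsonRing ℤ := by
  refine isJacobsonRing_iff_prime_eq.mpr fun P hP ↦ ?_
  rcases eq_or_ne P ⊥ with rfl | hP'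
  · refine le_antisymm (fun x hx ↦ ?_) Ideal.le_jacobson
    have hunit : IsUnit (x * x + 1) := Ideal.mem_jacobson_bot.mp hx x
    rcases Int.isUnit_iff.mp hunit with h | h
    · simpa using h
    · nlinarith
  · have := hP.isMaximal hP'
    exact Ideal.jacobson_eq_self_of_isMaximal

theorem finite_quotient_of_isMaximal {R : Type*} [CommRing R] [Algebra.FiniteType ℤ R]
    {m : Ideal R} (hm : m.IsMaximal) : Finite (R ⧸ m) := by
  let := Ideal.Quotient.field m
  have : Algebra.FiniteType ℤ (R ⧸ m) :=
    Algebra.FiniteType.of_surjective (Ideal.Quotient.mkₐ ℤ m) (Ideal.Quotient.mkₐ_surjective ℤ m)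
  have hfin : Module.Finite ℤ (R ⧸ m) := finite_of_finite_type_of_isJacobsonRing ℤ (R ⧸ m)
  have hchar : ¬ CharZero (R ⧸ m) := fun _ ↦
    Int.not_isField <| isField_of_isIntegral_of_isField (S := R ⧸ m)
      (RingHom.injective_int (algebraMap ℤ (R ⧸ m))) (Field.toIsField (R ⧸ m))
  obtain ⟨p, hp, hp0⟩ : ∃ p : ℕ, (p : R ⧸ m) = 0 ∧ p ≠ 0 := by
    contrapose! hchar
    exact charZero_of_inj_zero hchar
  exact Module.finite_of_fg_torsion (R ⧸ m) fun x ↦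
    ⟨⟨p, by simpa using hp0⟩, by simp [Submonoid.smul_def, hp]⟩

theorem exists_isMaximal_pair_natCast_notMem (R : Type*) [CommRing R] [IsDomain R] [CharZero R]
    [Algebra.FiniteType ℤ R] :
    ∃ m₁ m₂ : Ideal R, m₁.IsMaximal ∧ m₂.IsMaximal ∧
      ∀ q : ℕ, q.Prime → (q : R) ∉ m₁ ∨ (q : R) ∉ m₂ := by
  obtain ⟨m₁, hm₁⟩ := Ideal.exists_maximal R
  have := finite_quotient_of_isMaximal hm₁
  have hp : (ringChar (R ⧸ m₁)).Prime := CharP.char_is_prime (R ⧸ m₁) _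
  have hJ : IsJacobsonRing R := isJacobsonRing_of_finiteType (A := ℤ)
  have hbot : (ringChar (R ⧸ m₁) : R) ∉ (⊥ : Ideal R).jacobson := by
    rw [hJ.out Ideal.isPrime_bot.isRadical, Ideal.mem_bot]
    exact_mod_cast hp.ne_zero
  obtain ⟨m₂, ⟨-, hm₂⟩, hpm₂⟩ : ∃ m₂ ∈ {m : Ideal R | ⊥ ≤ m ∧ m.IsMaximal},
      (ringChar (R ⧸ m₁) : R) ∉ m₂ := by
    simpa only [Ideal.jacobson, Submodule.mem_sInf, not_forall, exists_prop] using hbot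
  refine ⟨m₁, m₂, hm₁, hm₂, fun q hq ↦ or_iff_not_imp_left.mpr fun h₁ ↦ ?_⟩
  rw [not_not, ← Ideal.Quotient.eq_zero_iff_mem, map_natCast, ringChar.spec,
    Nat.prime_dvd_prime_iff_eq hp hq] at h₁
  exact h₁ ▸ hpm₂

variable {n : Type*} [Fintype n] [DecidableEq n]

theorem eq_one_of_pow_eq_one_of_mapMatrix_eq_one {R S : Type*} [CommRing R] [IsDomain R]
    [CommRing S] [IsReduced S] (φ : R →+* S) {q : ℕ} (hq : (q : S) ≠ 0) {A : Matrix n n R}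
    (hA : A ^ q = 1) (hφ : φ.mapMatrix A = 1) : A = 1 := by
  -- The geometric sum `N` annihilates `A - 1`, and it reduces to the scalar `q ≠ 0`.
  set N : Matrix n n R := ∑ i ∈ Finset.range q, A ^ i
  have hN : (A - 1) * N = 0 := by rw [mul_geom_sum, hA, sub_self]
  have hφN : φ.mapMatrix N = q := by simp only [N, map_sum, map_pow, hφ, one_pow]; simp
  have hdet : N.det ≠ 0 := fun h ↦ by
    have h' : (q : S) ^ Fintype.card n = 0 := by
      rw [← map_zero φ, ← h, φ.map_det, hφN, ← Matrix.diagonal_natCast, Matrix.det_diagonal,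
        Finset.prod_const, Finset.card_univ]
    exact hq (eq_zero_of_pow_eq_zero h')
  have hzero : N.det • (A - 1) = 0 := by
    rw [← mul_one (A - 1), ← mul_smul_comm, ← Matrix.mul_adjugate, ← mul_assoc, hN, zero_mul]
  exact sub_eq_zero.mp ((smul_eq_zero.mp hzero).resolve_left hdet)

theorem finite_of_injective_of_forall_isOfFinOrder {R : Type*} [CommRing R] [IsDomain R]
    [CharZero R] [Algebra.FiniteType ℤ R] {Γ : Type*} [Group Γ] (ρ : Γ →* Matrix n n R)
    (hρ : Function.Injective ρ) (htors : ∀ g : Γ, IsOfFinOrder g) : Finite Γ := by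
  -- Two maximal ideals of distinct residue characteristics: an element of prime order cannot
  -- reduce to the identity modulo both of them.
  obtain ⟨m₁, m₂, hm₁, hm₂, hprime⟩ := exists_isMaximal_pair_natCast_notMem R
  have hfin {m : Ideal R} (hm : m.IsMaximal) : Finite (Matrix n n (R ⧸ m)) :=
    have := finite_quotient_of_isMaximal hm
    inferInstanceAs (Finite (n → n → R ⧸ m))
  have := hfin hm₁
  have := hfin hm₂
  let red (m : Ideal R) : Γ →* Matrix n n (R ⧸ m) :=
    (Ideal.Quotient.mk m).mapMatrix.toMonoidHom.comp ρ
  refine Finite.of_injective ((red m₁).prod (red m₂))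
    ((injective_iff_map_eq_one _).mpr fun g hg ↦ by_contra fun hne ↦ ?_)
  obtain ⟨q, hq, hdvd⟩ := Nat.exists_prime_and_dvd (mt orderOf_eq_one_iff.mp hne)
  set k := g ^ (orderOf g / q)
  have hk : orderOf k = q := orderOf_pow_orderOf_div (htors g).orderOf_pos.ne' hdvd
  have hkq : ρ k ^ q = 1 := by rw [← map_pow, ← hk, pow_orderOf_eq_one, map_one]
  have hred : red m₁ k = 1 ∧ red m₂ k = 1 := by
    rw [← Prod.mk_eq_one, ← MonoidHom.prod_apply, map_pow, hg, one_pow]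
  have hone : ρ k = 1 := by
    rcases hprime q hq with h | h
    · exact eq_one_of_pow_eq_one_of_mapMatrix_eq_one (Ideal.Quotient.mk m₁)
        (by rwa [← map_natCast (Ideal.Quotient.mk m₁), Ne, Ideal.Quotient.eq_zero_iff_mem])
        hkq hred.1
    · exact eq_one_of_pow_eq_one_of_mapMatrix_eq_one (Ideal.Quotient.mk m₂)
        (by rwa [← map_natCast (Ideal.Quotient.mk m₂), Ne, Ideal.Quotient.eq_zero_iff_mem])
        hkq hred.2
  have hk1 : k = 1 := hρ (hone.trans (map_one ρ).symm)
  exact hq.one_lt.ne (by rw [← hk, hk1, orderOf_one])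

theorem exists_fg_subalgebra_int_forall_mem {K : Type*} [CommRing K] {Γ : Type*} [Group Γ]
    [Group.FG Γ] (ρ : Γ →* Matrix n n K) :
    ∃ R : Subalgebra ℤ K, R.FG ∧ ∀ g i j, ρ g i j ∈ R := by
  obtain ⟨S, hS⟩ := (Monoid.fg_def.mp (Group.fg_iff_monoid_fg.mp ‹Group.FG Γ›))
  let entries : Set K := ⋃ g ∈ S, Set.range fun p : n × n ↦ ρ g p.1 p.2
  have hentries : entries.Finite := S.finite_toSet.biUnion fun g _ ↦ Set.finite_range _
  let R := Algebra.adjoin ℤ entries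
  have hle : Submonoid.closure (S : Set Γ) ≤ R.matrix.toSubmonoid.comap ρ :=
    Submonoid.closure_le.mpr fun g hg i j ↦
      Algebra.subset_adjoin (Set.mem_biUnion hg ⟨(i, j), rfl⟩)
  refine ⟨R, ⟨hentries.toFinset, by simp [R]⟩, fun g i j ↦ ?_⟩
  have hg : g ∈ Submonoid.closure (S : Set Γ) := hS ▸ Submonoid.mem_top g
  exact hle hg i j

theorem exists_not_isOfFinOrder_of_injective {K : Type*} [CommRing K] [IsDomain K] [CharZero K]
    {Γ : Type*} [Group Γ] [Group.FG Γ] [Infinite Γ] (ρ : Γ →* Matrix n n K)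
    (hρ : Function.Injective ρ) : ∃ g : Γ, ¬ IsOfFinOrder g := by
  by_contra! htors
  obtain ⟨R, hR, hmem⟩ := exists_fg_subalgebra_int_forall_mem ρ
  have := R.fg_iff_finiteType.mp hR
  let ρ' : Γ →* Matrix n n R :=
    { toFun g := .of fun i j ↦ ⟨ρ g i j, hmem g i j⟩
      map_one' := by ext i j; by_cases h : i = j <;> simp [Matrix.one_apply, h]
      map_mul' x y := by ext i j; simp [Matrix.mul_apply] }
  have hρ' : Function.Injective ρ' := fun x y h ↦ hρ <| Matrix.ext fun i j ↦
    congrArg Subtype.val (congrFun (congrFun h i) j)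
  exact not_finite_iff_infinite.mpr ‹_› (finite_of_injective_of_forall_isOfFinOrder ρ' hρ' htors)

end BurnsideSchur

/-! ### Rotations of three-dimensional space -/

namespace SO3

theorem ofLp_smul (g : SO3) (u : EuclideanSpace ℝ (Fin 3)) :
    (g • u).ofLp = (g : Matrix (Fin 3) (Fin 3) ℝ) *ᵥ u.ofLp := rfl

theorem isAxisVector_iff {g : SO3} {u : EuclideanSpace ℝ (Fin 3)} :
    IsAxisVector g u ↔ g • u = u ∧ u ≠ 0 := by
  rw [IsAxisVector, Module.End.hasEigenvector_iff, Module.End.mem_eigenspace_iff, one_smul]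
  rfl

theorem mul_transpose (g : SO3) :
    (g : Matrix (Fin 3) (Fin 3) ℝ) * (g : Matrix (Fin 3) (Fin 3) ℝ)ᵀ = 1 :=
  congrArg Subtype.val (mul_inv_cancel g)

theorem transpose_mul (g : SO3) :
    (g : Matrix (Fin 3) (Fin 3) ℝ)ᵀ * (g : Matrix (Fin 3) (Fin 3) ℝ) = 1 :=
  congrArg Subtype.val (inv_mul_cancel g)

theorem det_eq_one (g : SO3) : (g : Matrix (Fin 3) (Fin 3) ℝ).det = 1 :=
  (Matrix.mem_specialOrthogonalGroup_iff.mp g.2).2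

theorem norm_smul_eq (g : SO3) (u : EuclideanSpace ℝ (Fin 3)) : ‖g • u‖ = ‖u‖ := by
  have h : inner ℝ (g • u) (g • u) = inner ℝ u u := by
    simp only [EuclideanSpace.inner_eq_star_dotProduct, star_trivial, ofLp_smul,
      Matrix.dotProduct_mulVec, Matrix.vecMul_mulVec, transpose_mul, Matrix.vecMul_one]
  rw [norm_eq_sqrt_real_inner, h, ← norm_eq_sqrt_real_inner]

theorem smul_mem_span_singleton_iff {g : SO3} {u : EuclideanSpace ℝ (Fin 3)} :
    g • u ∈ ℝ ∙ u ↔ g • u = u ∨ g • u = -u := by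
  refine ⟨fun h ↦ ?_, ?_⟩
  · obtain ⟨r, hr⟩ := Submodule.mem_span_singleton.mp h
    rcases eq_or_ne u 0 with rfl | hu
    · exact .inl (smul_zero g)
    have hnorm : ‖r‖ * ‖u‖ = 1 * ‖u‖ := by rw [← norm_smul, hr, norm_smul_eq, one_mul]
    rcases (Real.norm_eq_abs r ▸ mul_right_cancel₀ (norm_ne_zero_iff.mpr hu) hnorm :
      |r| = 1) |> eq_or_eq_neg_of_abs_eq with rfl | rfl
    · exact .inl (by rw [← hr, one_smul])
    · exact .inr (by rw [← hr, neg_one_smul])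
  · rintro (h | h) <;> rw [h]
    exacts [Submodule.mem_span_singleton_self u, neg_mem (Submodule.mem_span_singleton_self u)]

theorem exists_ne_zero_smul_eq (g : SO3) : ∃ u : EuclideanSpace ℝ (Fin 3), u ≠ 0 ∧ g • u = u := by
  set M := (g : Matrix (Fin 3) (Fin 3) ℝ) with hM
  have hfactor : M - 1 = M * (1 - M)ᵀ := by
    rw [Matrix.transpose_sub, Matrix.transpose_one, mul_sub, hM, mul_transpose, mul_one]
  -- In odd dimension this makes the determinant of `g - 1` equal to its opposite.
  have hdet : (M - 1).det = -(M - 1).det := calc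
    (M - 1).det = (1 - M).det := by
      rw [hfactor, Matrix.det_mul, hM, det_eq_one, one_mul, Matrix.det_transpose]
    _ = -(M - 1).det := by rw [← neg_sub, Matrix.det_neg]; simp [pow_succ]
  obtain ⟨u, hu, h⟩ := Matrix.exists_mulVec_eq_zero_iff.mpr (self_eq_neg.mp hdet)
  refine ⟨WithLp.toLp 2 u, by simpa using hu, WithLp.ofLp_injective 2 ?_⟩
  rwa [Matrix.sub_mulVec, Matrix.one_mulVec, sub_eq_zero] at h

/-- The rotation of angle `θ` about the first coordinate axis. -/
def rot (θ : ℝ) : SO3 := ⟨rotMatrix θ, by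
  have h := Real.sin_sq_add_cos_sq θ
  rw [Matrix.mem_specialOrthogonalGroup_iff, Matrix.mem_orthogonalGroup_iff]
  constructor
  · ext i j
    fin_cases i <;> fin_cases j <;>
      simp [rotMatrix, Matrix.mul_apply, Fin.sum_univ_three] <;> linarith
  · simp [rotMatrix, Matrix.det_fin_three]; linarith⟩

theorem coe_rot (θ : ℝ) : (rot θ : Matrix (Fin 3) (Fin 3) ℝ) = rotMatrix θ := rfl

theorem rot_add (a b : ℝ) : rot (a + b) = rot a * rot b := by
  apply Subtype.ext
  rw [Submonoid.coe_mul, coe_rot, coe_rot, coe_rot]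
  ext i j
  fin_cases i <;> fin_cases j <;>
    simp [rotMatrix, Matrix.mul_apply, Fin.sum_univ_three, Real.cos_add, Real.sin_add] <;> ring

theorem rot_eq_one_iff {θ : ℝ} : rot θ = 1 ↔ Real.cos θ = 1 := by
  refine ⟨fun h ↦ ?_, fun h ↦ Subtype.ext ?_⟩
  · simpa [coe_rot, rotMatrix] using congrArg (fun g : SO3 ↦ (g : Matrix (Fin 3) (Fin 3) ℝ) 1 1) h
  · have hs : Real.sin θ = 0 := by simpa [h] using Real.sin_sq_add_cos_sq θ
    ext i j
    fin_cases i <;> fin_cases j <;> simp [coe_rot, rotMatrix, h, hs]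

theorem rot_pow (θ : ℝ) (n : ℕ) : rot θ ^ n = rot (n * θ) := by
  induction n with
  | zero => rw [pow_zero, eq_comm, rot_eq_one_iff]; simp
  | succ n ih => rw [pow_succ, ih, ← rot_add]; push_cast; ring_nf

theorem isRotationAngle_iff {C : SO3} {θ : ℝ} :
    IsRotationAngle C θ ↔ ∃ V : SO3, C = V * rot θ * V⁻¹ :=
  exists_congr fun _ ↦ ⟨fun h ↦ Subtype.ext h, fun h ↦ congrArg Subtype.val h⟩

/-- The unit vector on the axis of the rotations `rot θ`. -/
abbrev e₀ : EuclideanSpace ℝ (Fin 3) := EuclideanSpace.single 0 1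

theorem smul_e₀_apply (g : SO3) (i : Fin 3) : (g • e₀) i = (g : Matrix (Fin 3) (Fin 3) ℝ) i 0 :=
  congrFun (Matrix.mulVec_single_one (g : Matrix (Fin 3) (Fin 3) ℝ) 0) i

theorem exists_eq_rot_of_smul_e₀ {g : SO3} (hg : g • e₀ = e₀) : ∃ θ, g = rot θ := by
  set M := (g : Matrix (Fin 3) (Fin 3) ℝ) with hM
  have hcol (i : Fin 3) : M i 0 = e₀ i := by rw [hM, ← smul_e₀_apply, hg]
  have hrow (i : Fin 3) : M 0 i = e₀ i := by
    rw [← inv_smul_eq_iff.mpr hg.symm, smul_e₀_apply]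
    rfl
  simp only [PiLp.single_apply] at hcol hrow
  have hblock : !![M 1 1, M 1 2; M 2 1, M 2 2] ∈ Matrix.specialOrthogonalGroup (Fin 2) ℝ := by
    have hmul (i j : Fin 3) := congrFun (congrFun (mul_transpose g) i) j
    have hdet := det_eq_one g
    rw [Matrix.mem_specialOrthogonalGroup_iff, Matrix.mem_orthogonalGroup_iff]
    simp only [Matrix.mul_apply, Fin.sum_univ_three, Matrix.transpose_apply, ← hM] at hmul
    constructor
    · ext i j
      fin_cases i <;> fin_cases j
      · simpa [Matrix.mul_apply, hcol] using hmul 1 1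
      · simpa [Matrix.mul_apply, hcol] using hmul 1 2
      · simpa [Matrix.mul_apply, hcol] using hmul 2 1
      · simpa [Matrix.mul_apply, hcol] using hmul 2 2
    · simpa [← hM, Matrix.det_fin_three, Matrix.det_fin_two, hcol, hrow] using hdet
  obtain ⟨h11, h12, hsq⟩ := Matrix.of_mem_specialOrthogonalGroup_fin_two_iff.mp hblock
  obtain ⟨θ, hθ⟩ := (Complex.norm_eq_one_iff ⟨M 1 1, M 2 1⟩).mp (by
    rw [Complex.norm_eq_sqrt_sq_add_sq, Real.sqrt_eq_one, ← hsq, h12, neg_sq])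
  have hcos : Real.cos θ = M 1 1 := by simpa using congrArg Complex.re hθ
  have hsin : Real.sin θ = M 2 1 := by simpa using congrArg Complex.im hθ
  refine ⟨θ, Subtype.ext ?_⟩
  rw [coe_rot, rotMatrix, hcos, hsin]
  ext i j
  fin_cases i <;> fin_cases j <;> simp [← hM, hcol, hrow, h12, ← h11]

theorem exists_eq_smul_smul_e₀ (u : EuclideanSpace ℝ (Fin 3)) :
    ∃ (V : SO3) (r : ℝ), u = r • V • e₀ := by
  rcases eq_or_ne u 0 with rfl | hu
  · exact ⟨1, 0, by simp⟩
  obtain ⟨b, hb⟩ := Orthonormal.exists_orthonormalBasis_extension_of_card_eq (𝕜 := ℝ)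
    (v := fun _ : Fin 3 ↦ ‖u‖⁻¹ • u) (s := {0}) (by simp)
    ⟨fun _ ↦ by simp [norm_smul, hu], fun i j hij ↦ absurd (Subsingleton.elim i j) hij⟩
  let M : Matrix (Fin 3) (Fin 3) ℝ := (EuclideanSpace.basisFun (Fin 3) ℝ).toBasis.toMatrix b
  have hM : M * Mᵀ = 1 := (Matrix.mem_orthogonalGroup_iff _ _).mp <|
    (EuclideanSpace.basisFun (Fin 3) ℝ).toMatrix_orthonormalBasis_mem_orthogonal b
  have hdet : M.det * M.det = 1 := by
    simpa only [Matrix.det_mul, Matrix.det_transpose, Matrix.det_one] using congrArg Matrix.det hM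
  -- The sign `M.det` makes the determinant `M.det ^ 3 * M.det = 1`.
  let V : SO3 := ⟨M.det • M, by
    rw [Matrix.mem_specialOrthogonalGroup_iff, Matrix.mem_orthogonalGroup_iff]
    constructor
    · rw [Matrix.transpose_smul, smul_mul_smul_comm, hM, hdet, one_smul]
    · rw [Matrix.det_smul, Fintype.card_fin]
      linear_combination (M.det * M.det + 1) * hdet⟩
  refine ⟨V, ‖u‖ * M.det, ?_⟩
  ext i
  have hcol : M i 0 = ‖u‖⁻¹ * u i := by
    simp [M, Module.Basis.toMatrix_apply, hb]
  have hnorm : ‖u‖ * ‖u‖⁻¹ = 1 := mul_inv_cancel₀ (norm_ne_zero_iff.mpr hu)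
  rw [PiLp.smul_apply, smul_e₀_apply]
  simp only [V, Matrix.smul_apply, hcol, smul_eq_mul]
  linear_combination -u i * hdet - M.det * M.det * u i * hnorm

theorem exists_forall_smul_eq_imp_eq_conj_rot {u : EuclideanSpace ℝ (Fin 3)} (hu : u ≠ 0) :
    ∃ (V : SO3) (r : ℝ), u = r • V • e₀ ∧ ∀ g : SO3, g • u = u → ∃ θ, g = V * rot θ * V⁻¹ := by
  obtain ⟨V, r, rfl⟩ := exists_eq_smul_smul_e₀ u
  refine ⟨V, r, rfl, fun g hg ↦ ?_⟩
  rw [smul_comm g r] at hg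
  have hg' : g • V • e₀ = V • e₀ := smul_right_injective _ (left_ne_zero_of_smul hu) hg
  obtain ⟨θ, hθ⟩ := exists_eq_rot_of_smul_e₀ (g := V⁻¹ * g * V) (by
    rw [mul_smul, mul_smul, hg', inv_smul_smul])
  exact ⟨θ, by rw [← hθ]; group⟩

theorem commute_of_smul_eq {u : EuclideanSpace ℝ (Fin 3)} (hu : u ≠ 0) {g h : SO3}
    (hg : g • u = u) (hh : h • u = u) : Commute g h := by
  obtain ⟨V, -, -, hV⟩ := exists_forall_smul_eq_imp_eq_conj_rot hu
  obtain ⟨a, rfl⟩ := hV g hg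
  obtain ⟨b, rfl⟩ := hV h hh
  have hab : rot a * rot b = rot b * rot a := by rw [← rot_add, ← rot_add, add_comm]
  rw [commute_iff_eq, conj_mul, conj_mul, hab]

theorem mem_span_e₀_of_rot_smul_eq {θ : ℝ} (hθ : rot θ ≠ 1) {u : EuclideanSpace ℝ (Fin 3)}
    (hu : rot θ • u = u) : u ∈ ℝ ∙ e₀ := by
  have hcos : Real.cos θ < 1 :=
    lt_of_le_of_ne (Real.cos_le_one θ) fun h ↦ hθ (rot_eq_one_iff.mpr h)
  have hcoord (i : Fin 3) : (rotMatrix θ *ᵥ u.ofLp) i = u i := by rw [← coe_rot, ← ofLp_smul, hu]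
  have h1 : Real.cos θ * u 1 - Real.sin θ * u 2 = u 1 := by
    simpa [rotMatrix, Matrix.mulVec, dotProduct, Fin.sum_univ_three, ← sub_eq_add_neg]
      using hcoord 1
  have h2 : Real.sin θ * u 1 + Real.cos θ * u 2 = u 2 := by
    simpa [rotMatrix, Matrix.mulVec, dotProduct, Fin.sum_univ_three] using hcoord 2
  have hsum : (1 - Real.cos θ) * (u 1 ^ 2 + u 2 ^ 2) = 0 := by
    linear_combination -u 1 * h1 - u 2 * h2
  have hzero : u 1 ^ 2 + u 2 ^ 2 = 0 := (mul_eq_zero.mp hsum).resolve_left (by linarith)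
  have hu1 : u 1 = 0 := by nlinarith [sq_nonneg (u 1), sq_nonneg (u 2)]
  have hu2 : u 2 = 0 := by nlinarith [sq_nonneg (u 1), sq_nonneg (u 2)]
  refine Submodule.mem_span_singleton.mpr ⟨u 0, ?_⟩
  ext i
  fin_cases i <;> simp [hu1, hu2]

theorem mem_span_of_smul_eq {u v : EuclideanSpace ℝ (Fin 3)} (hu : u ≠ 0) {g : SO3} (hg : g ≠ 1)
    (hgu : g • u = u) (hgv : g • v = v) : v ∈ ℝ ∙ u := by
  obtain ⟨V, r, hVu, hV⟩ := exists_forall_smul_eq_imp_eq_conj_rot hu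
  obtain ⟨θ, rfl⟩ := hV g hgu
  have hθ : rot θ ≠ 1 := fun h ↦ hg (by rw [h]; group)
  have hfix : rot θ • V⁻¹ • v = V⁻¹ • v := by
    rwa [mul_smul, mul_smul, ← eq_inv_smul_iff] at hgv
  obtain ⟨s, hs⟩ := Submodule.mem_span_singleton.mp (mem_span_e₀_of_rot_smul_eq hθ hfix)
  have hr : r ≠ 0 := left_ne_zero_of_smul (hVu ▸ hu)
  refine Submodule.mem_span_singleton.mpr ⟨s / r, ?_⟩
  rw [hVu, smul_smul, div_mul_cancel₀ s hr, ← smul_comm V s, hs, smul_inv_smul]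

theorem smul_mem_span_of_commute {u : EuclideanSpace ℝ (Fin 3)} (hu : u ≠ 0) {g h : SO3}
    (hg : g ≠ 1) (hgu : g • u = u) (hgh : Commute g h) : h • u ∈ ℝ ∙ u :=
  mem_span_of_smul_eq hu hg hgu (by rw [← mul_smul, hgh.eq, mul_smul, hgu])

theorem sq_eq_one_of_smul_eq_neg {g : SO3} {u : EuclideanSpace ℝ (Fin 3)} (hu : u ≠ 0)
    (hg : g • u = -u) : g ^ 2 = 1 := by
  by_contra hne
  obtain ⟨b, hb, hgb⟩ := exists_ne_zero_smul_eq g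
  have hgu : g ^ 2 • u = u := by
    rw [sq, mul_smul, hg, smul_neg, hg, neg_neg]
  obtain ⟨r, rfl⟩ := Submodule.mem_span_singleton.mp <|
    mem_span_of_smul_eq hb hne (by rw [sq, mul_smul, hgb, hgb]) hgu
  rw [smul_comm, hgb, eq_neg_iff_add_eq_zero, ← two_smul ℝ] at hg
  exact hu ((smul_eq_zero.mp hg).resolve_left two_ne_zero)

end SO3

section Eigenvalues

theorem exists_irrational_eq_exp {z : ℂ} (hz : ‖z‖ = 1) (hord : ¬ IsOfFinOrder z) :
    ∃ ψ : ℝ, Irrational ψ ∧ z = Complex.exp (Complex.I * ψ * Real.pi) := by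
  obtain ⟨θ, rfl⟩ := (Complex.norm_eq_one_iff z).mp hz
  have hθ : θ = θ / Real.pi * Real.pi := (div_mul_cancel₀ _ Real.pi_ne_zero).symm
  refine ⟨θ / Real.pi, ?_, by rw [mul_assoc, ← Complex.ofReal_mul, ← hθ, mul_comm]⟩
  rintro ⟨q, hq⟩
  refine hord (isOfFinOrder_iff_pow_eq_one.mpr ⟨2 * q.den, by positivity, ?_⟩)
  have hqd : (q : ℂ) * q.den = q.num := by exact_mod_cast Rat.mul_den_eq_num q
  rw [hθ, ← hq, ← Complex.exp_nat_mul, Complex.exp_eq_one_iff]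
  refine ⟨q.num, ?_⟩
  push_cast
  linear_combination 2 * Real.pi * Complex.I * hqd

open scoped Matrix.Norms.L2Operator in
theorem exists_hasEigenvalue_not_isOfFinOrder {n : Type*} [Fintype n] [DecidableEq n]
    {A : Matrix n n ℂ} (hA : A ∈ Matrix.unitaryGroup n ℂ) (hord : ¬ IsOfFinOrder A) :
    ∃ z : ℂ, Module.End.HasEigenvalue (Matrix.toLin' A) z ∧ ‖z‖ = 1 ∧ ¬ IsOfFinOrder z := by
  have hnormal : IsStarNormal A := ⟨by
    rw [commute_iff_eq, Unitary.star_mul_self_of_mem hA, Unitary.mul_star_self_of_mem hA]⟩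
  have hspec : ∀ z ∈ spectrum ℂ A, Module.End.HasEigenvalue (Matrix.toLin' A) z := fun z hz ↦ by
    rwa [Module.End.hasEigenvalue_iff_mem_spectrum, Matrix.spectrum_toLin']
  have hfinite := Matrix.finite_spectrum A
  by_contra! htors
  have htors' : ∀ z ∈ spectrum ℂ A, IsOfFinOrder z := fun z hz ↦
    htors z (hspec z hz) (by simpa using spectrum.subset_circle_of_unitary hA hz)
  let N := ∏ z ∈ hfinite.toFinset, orderOf z
  have hN : 0 < N := Finset.prod_pos fun z hz ↦ (htors' z (hfinite.mem_toFinset.mp hz)).orderOf_pos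
  refine hord (isOfFinOrder_iff_pow_eq_one.mpr ⟨N, hN, ?_⟩)
  calc A ^ N = cfc (fun z ↦ z ^ N) A := (cfc_pow_id A N).symm
    _ = cfc (fun _ ↦ 1) A := cfc_congr fun z hz ↦ orderOf_dvd_iff_pow_eq_one.mp <|
      Finset.dvd_prod_of_mem _ (hfinite.mem_toFinset.mpr hz)
    _ = 1 := cfc_const_one ℂ A

theorem SO3.exists_hasEigenvalue_exp_irrational {g : SO3} (hg : ¬ IsOfFinOrder g) :
    ∃ (ζ : ℂ) (ψ : ℝ), Module.End.HasEigenvalue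
      (Matrix.toLin' ((g : Matrix (Fin 3) (Fin 3) ℝ).map (algebraMap ℝ ℂ))) ζ ∧
    ζ ≠ 1 ∧ Irrational ψ ∧ ζ = Complex.exp (Complex.I * ψ * Real.pi) := by
  let f : SO3 →* Matrix (Fin 3) (Fin 3) ℂ :=
    (algebraMap ℝ ℂ).mapMatrix.toMonoidHom.comp (Submonoid.subtype _)
  have hf : Function.Injective f :=
    (Matrix.map_injective (algebraMap ℝ ℂ).injective).comp Subtype.val_injective
  have hunitary : f g ∈ Matrix.unitaryGroup (Fin 3) ℂ := by
    have hstar : star (f g) = ((g : Matrix (Fin 3) (Fin 3) ℝ)ᵀ).map (algebraMap ℝ ℂ) := by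
      ext i j
      exact Complex.conj_ofReal _
    rw [Matrix.mem_unitaryGroup_iff, hstar]
    calc f g * ((g : Matrix (Fin 3) (Fin 3) ℝ)ᵀ).map (algebraMap ℝ ℂ)
      _ = (algebraMap ℝ ℂ).mapMatrix ((g : Matrix (Fin 3) (Fin 3) ℝ) * (g : Matrix _ _ ℝ)ᵀ) :=
        Matrix.map_mul.symm
      _ = 1 := by rw [mul_transpose, map_one]
  obtain ⟨ζ, hζ, hnorm, hord⟩ := exists_hasEigenvalue_not_isOfFinOrder hunitary
    (mt hf.isOfFinOrder_iff.mp hg)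
  obtain ⟨ψ, hψ, hexp⟩ := exists_irrational_eq_exp hnorm hord
  exact ⟨ζ, ψ, hζ, fun h ↦ hord (h ▸ IsOfFinOrder.one), hψ, hexp⟩

end Eigenvalues

section PairsOfRotations

theorem SO3.exists_not_isOfFinOrder (H : Subgroup SO3) [Group.FG H] [Infinite H] :
    ∃ g ∈ H, ¬ IsOfFinOrder g := by
  obtain ⟨g, hg⟩ := exists_not_isOfFinOrder_of_injective
    ((Submonoid.subtype (Matrix.specialOrthogonalGroup (Fin 3) ℝ)).comp H.subtype)
    (Subtype.val_injective.comp Subtype.val_injective)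
  exact ⟨g, g.2, mt Submonoid.isOfFinOrder_coe.mp hg⟩

theorem exists_conditions_of_smul_notMem_span {H : Subgroup SO3} {g h : SO3} (hgH : g ∈ H)
    (hhH : h ∈ H) (hg : ¬ IsOfFinOrder g) {u : EuclideanSpace ℝ (Fin 3)} (hu : u ≠ 0)
    (hgu : g • u = u) (hhu : h • u ∉ ℝ ∙ u) :
    ∃ C : Fin 2 → SO3, (∀ k, C k ∈ H) ∧ ConditionA C ∧ ConditionB C ∧ ConditionC C := by
  have hsq {x : SO3} (hx : ¬ IsOfFinOrder x) : x ^ 2 ≠ 1 := fun h ↦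
    hx (isOfFinOrder_iff_pow_eq_one.mpr ⟨2, two_pos, h⟩)
  have hne {x : SO3} (hx : ¬ IsOfFinOrder x) : x ≠ 1 := fun h ↦ hx (h ▸ IsOfFinOrder.one)
  have hconj : ¬ IsOfFinOrder (h * g * h⁻¹) := fun hfin ↦
    hg ((isConj_iff.mpr ⟨h⁻¹, by group⟩ : IsConj (h * g * h⁻¹) g).isOfFinOrder hfin)
  have hconj_smul : (h * g * h⁻¹) • h • u = h • u := by
    rw [← mul_smul, inv_mul_cancel_right, mul_smul, hgu]
  refine ⟨![g, h * g * h⁻¹], Fin.forall_fin_two.mpr ⟨hgH, ?_⟩,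
    Fin.forall_fin_two.mpr ⟨hsq hg, hsq hconj⟩, fun a b ha hb ↦ ?_,
    ⟨0, SO3.exists_hasEigenvalue_exp_irrational hg⟩⟩
  · exact H.mul_mem (H.mul_mem hhH hgH) (H.inv_mem hhH)
  · obtain ⟨ha, ha0⟩ := SO3.isAxisVector_iff.mp ha
    obtain ⟨hb, hb0⟩ := SO3.isAxisVector_iff.mp hb
    rw [LinearIndependent.pair_iff' ha0]
    rintro r rfl
    have hmem : h • u ∈ ℝ ∙ (r • a) := SO3.mem_span_of_smul_eq hb0 (hne hconj) hb hconj_smul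
    have hle : ℝ ∙ (r • a) ≤ ℝ ∙ u := (Submodule.span_singleton_le_iff_mem _ _).mpr <|
      Submodule.smul_mem _ r (SO3.mem_span_of_smul_eq hu (hne hg) hgu ha)
    exact hhu (hle hmem)

theorem finite_closure_pair_of_mem_normalizer {Γ : Type*} [Group Γ] {a b : Γ}
    (ha : IsOfFinOrder a) (hb : IsOfFinOrder b)
    (hab : b ∈ Subgroup.normalizer (Subgroup.zpowers a : Set Γ)) :
    Finite (Subgroup.closure {a, b}) := by
  have hsup : Subgroup.closure {a, b} = Subgroup.zpowers b ⊔ Subgroup.zpowers a := by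
    rw [Set.pair_comm, Set.insert_eq, Subgroup.closure_union, Subgroup.zpowers_eq_closure,
      Subgroup.zpowers_eq_closure]
  have hmul := Subgroup.coe_mul_of_left_le_normalizer_right (Subgroup.zpowers b)
    (Subgroup.zpowers a) (Subgroup.zpowers_le.mpr hab)
  have hfinite : ((Subgroup.closure {a, b} : Subgroup Γ) : Set Γ).Finite := by
    rw [hsup, hmul]
    exact (finite_zpowers.mpr hb).mul (finite_zpowers.mpr ha)
  exact hfinite

theorem finite_closure_pair_of_smul_mem_span {A B : SO3} (hA : IsOfFinOrder A) (hA2 : A ^ 2 ≠ 1)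
    (hAB : ∀ u, IsAxisVector A u → ¬ IsAxisVector B u) {u : EuclideanSpace ℝ (Fin 3)} (hu : u ≠ 0)
    (hAu : A • u ∈ ℝ ∙ u) (hBu : B • u ∈ ℝ ∙ u) : Finite (Subgroup.closure {A, B}) := by
  have hAu : A • u = u := (SO3.smul_mem_span_singleton_iff.mp hAu).resolve_right fun h ↦
    hA2 (SO3.sq_eq_one_of_smul_eq_neg hu h)
  have hBu : B • u = -u := (SO3.smul_mem_span_singleton_iff.mp hBu).resolve_left fun h ↦
    hAB u (SO3.isAxisVector_iff.mpr ⟨hAu, hu⟩) (SO3.isAxisVector_iff.mpr ⟨h, hu⟩)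
  have hB2 : B ^ 2 = 1 := SO3.sq_eq_one_of_smul_eq_neg hu hBu
  have hBA2 : (B * A) ^ 2 = 1 :=
    SO3.sq_eq_one_of_smul_eq_neg hu (by rw [mul_smul, hAu, hBu])
  have hconj : B * A * B⁻¹ = A⁻¹ := by
    rw [inv_eq_of_mul_eq_one_left (sq B ▸ hB2), eq_inv_iff_mul_eq_one, mul_assoc, ← sq, hBA2]
  refine finite_closure_pair_of_mem_normalizer hA
    (isOfFinOrder_iff_pow_eq_one.mpr ⟨2, two_pos, hB2⟩) ?_
  rw [Subgroup.mem_normalizer_iff_map_conj_eq, MonoidHom.map_zpowers]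
  exact (congrArg Subgroup.zpowers hconj).trans Subgroup.zpowers_inv

theorem SO3.sq_smul_eq_of_smul_mem_span {g : SO3} {u : EuclideanSpace ℝ (Fin 3)}
    (h : g • u ∈ ℝ ∙ u) : g ^ 2 • u = u := by
  rw [sq, mul_smul]
  rcases smul_mem_span_singleton_iff.mp h with h | h <;> simp only [h, smul_neg, neg_neg]

theorem SO3.smul_mem_span_of_commute_sq {g x : SO3} (hg : ¬ IsOfFinOrder g)
    {u : EuclideanSpace ℝ (Fin 3)} (hu : u ≠ 0) (hgu : g • u = u)
    (hcomm : Commute (g ^ 2) ((x * g * x⁻¹) ^ 2)) : x • u ∈ ℝ ∙ u := by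
  have hpow_ne {n : ℕ} (hn : 0 < n) : g ^ n ≠ 1 := fun h ↦
    hg (isOfFinOrder_iff_pow_eq_one.mpr ⟨n, hn, h⟩)
  have hpow_smul (n : ℕ) : g ^ n • u = u := (MulAction.stabilizer SO3 u).pow_mem hgu n
  -- Both `u` and `x • u` lie on the axis of the conjugate of `g ^ 4` by `x`.
  have hconj : ((x * g * x⁻¹) ^ 2) ^ 2 = x * g ^ 4 * x⁻¹ := by rw [← pow_mul, conj_pow]
  refine mem_span_of_smul_eq hu (g := x * g ^ 4 * x⁻¹)
    (mt conj_eq_one_iff.mp (hpow_ne four_pos)) ?_ ?_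
  · rw [← hconj]
    exact sq_smul_eq_of_smul_mem_span <|
      smul_mem_span_of_commute hu (hpow_ne two_pos) (hpow_smul 2) hcomm
  · rw [← mul_smul, inv_mul_cancel_right, mul_smul, hpow_smul]

theorem isOfFinOrder_of_forall_commute_sq {A B : SO3} (hA : IsOfFinOrder A) (hA2 : A ^ 2 ≠ 1)
    (hAB : ∀ u, IsAxisVector A u → ¬ IsAxisVector B u)
    (hcomm : ∀ x y : Subgroup.closure {A, B}, Commute (x ^ 2) (y ^ 2))
    (g : Subgroup.closure {A, B}) : IsOfFinOrder g := by
  by_contra hg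
  obtain ⟨u, hu, hgu⟩ := SO3.exists_ne_zero_smul_eq (g : SO3)
  have hline (x : Subgroup.closure {A, B}) : (x : SO3) • u ∈ ℝ ∙ u :=
    SO3.smul_mem_span_of_commute_sq (mt Submonoid.isOfFinOrder_coe.mp hg) hu hgu
      ((hcomm g (x * g * x⁻¹)).map (Subgroup.subtype _))
  have : Finite (Subgroup.closure {A, B}) := finite_closure_pair_of_smul_mem_span hA hA2 hAB hu
    (hline ⟨A, Subgroup.subset_closure (by simp)⟩) (hline ⟨B, Subgroup.subset_closure (by simp)⟩)
  exact hg (isOfFinOrder_of_finite g)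

theorem exists_conditions_of_mulEquiv {H : Subgroup SO3} [Group.FG H] [Infinite H] {A B : SO3}
    (hA : IsOfFinOrder A) (hA2 : A ^ 2 ≠ 1) (hAB : ∀ u, IsAxisVector A u → ¬ IsAxisVector B u)
    (f : H ≃* Subgroup.closure {A, B}) :
    ∃ C : Fin 2 → SO3, (∀ k, C k ∈ H) ∧ ConditionA C ∧ ConditionB C ∧ ConditionC C := by
  obtain ⟨g, hgH, hg⟩ := SO3.exists_not_isOfFinOrder H
  obtain ⟨u, hu, hgu⟩ := SO3.exists_ne_zero_smul_eq g
  by_cases! hline : ∃ h ∈ H, h • u ∉ ℝ ∙ u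
  · obtain ⟨h, hhH, hhu⟩ := hline
    exact exists_conditions_of_smul_notMem_span hgH hhH hg hu hgu hhu
  have hcomm (x y : H) : Commute (x ^ 2) (y ^ 2) := Subtype.ext <|
    SO3.commute_of_smul_eq hu (SO3.sq_smul_eq_of_smul_mem_span (hline x x.2))
      (SO3.sq_smul_eq_of_smul_mem_span (hline y y.2))
  have hcomm' (x y : Subgroup.closure {A, B}) : Commute (x ^ 2) (y ^ 2) := by
    simpa only [map_pow, f.apply_symm_apply] using (hcomm (f.symm x) (f.symm y)).map f
  have hf : IsOfFinOrder (f ⟨g, hgH⟩) ↔ IsOfFinOrder (⟨g, hgH⟩ : H) :=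
    f.injective.isOfFinOrder_iff (f := f.toMonoidHom)
  have hfin : IsOfFinOrder (f ⟨g, hgH⟩) := isOfFinOrder_of_forall_commute_sq hA hA2 hAB hcomm' _
  exact absurd (Submonoid.isOfFinOrder_coe.mpr (hf.mp hfin)) hg

end PairsOfRotations

section HalvedAngles

variable {A B C : SO3} {θ φ : ℝ}

theorem IsRotationAngle.pow_eq_one_iff (h : IsRotationAngle C θ) (n : ℕ) :
    C ^ n = 1 ↔ Real.cos (n * θ) = 1 := by
  obtain ⟨V, rfl⟩ := SO3.isRotationAngle_iff.mp h
  rw [conj_pow, SO3.rot_pow, conj_eq_one_iff, SO3.rot_eq_one_iff]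

theorem IsRotationAngle.ne_one (h : IsRotationAngle C θ) (hθ : θ ∈ Ioo 0 (2 * Real.pi)) :
    C ≠ 1 := by
  rw [← pow_one C, Ne, h.pow_eq_one_iff, Nat.cast_one, one_mul,
    Real.cos_eq_one_iff_of_lt_of_lt (by linarith [hθ.1, Real.pi_pos]) hθ.2]
  exact hθ.1.ne'

theorem IsRotationAngle.pow_two_mul_eq_one_iff (hA : IsRotationAngle A (θ / 2))
    (hC : IsRotationAngle C θ) (n : ℕ) : A ^ (2 * n) = 1 ↔ C ^ n = 1 := by
  rw [hA.pow_eq_one_iff, hC.pow_eq_one_iff]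
  push_cast
  ring_nf

theorem IsRotationAngle.isOfFinOrder_of_half (hA : IsRotationAngle A (θ / 2))
    (hC : IsRotationAngle C θ) (hfin : IsOfFinOrder C) : IsOfFinOrder A := by
  obtain ⟨n, hn, hCn⟩ := isOfFinOrder_iff_pow_eq_one.mp hfin
  exact isOfFinOrder_iff_pow_eq_one.mpr
    ⟨2 * n, by positivity, (hA.pow_two_mul_eq_one_iff hC n).mpr hCn⟩

theorem IsRotationAngle.sq_ne_one_of_half (hA : IsRotationAngle A (θ / 2))
    (hC : IsRotationAngle C θ) (hθ : θ ∈ Ioo 0 (2 * Real.pi)) : A ^ 2 ≠ 1 := fun h ↦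
  hC.ne_one hθ (by simpa using (hA.pow_two_mul_eq_one_iff hC 1).mp h)

theorem IsAxisAngle.not_isAxisVector (h : IsAxisAngle A B φ) (hA : A ≠ 1) (hB : B ≠ 1)
    {u : EuclideanSpace ℝ (Fin 3)} (hAu : IsAxisVector A u) : ¬ IsAxisVector B u := by
  intro hBu
  obtain ⟨hφ, a, b, hAa, hBb, rfl⟩ := h
  rw [SO3.isAxisVector_iff] at hAu hBu hAa hBb
  have hu : u ∈ ℝ ∙ a := SO3.mem_span_of_smul_eq hAa.2 hA hAa.1 hAu.1
  have hb : b ∈ ℝ ∙ u := SO3.mem_span_of_smul_eq hBu.2 hB hBu.1 hBb.1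
  obtain ⟨r, rfl⟩ := Submodule.mem_span_singleton.mp
    ((Submodule.span_singleton_le_iff_mem _ _).mpr hu hb)
  rcases (left_ne_zero_of_smul hBb.2).lt_or_gt with hr | hr
  · rw [InnerProductGeometry.angle_smul_right_of_neg _ _ hr,
      InnerProductGeometry.angle_self_neg_of_nonzero hAa.2] at hφ
    linarith [hφ.2, Real.pi_pos]
  · rw [InnerProductGeometry.angle_smul_right_of_pos _ _ hr,
      InnerProductGeometry.angle_self hAa.2] at hφ
    exact hφ.1.false

theorem IsHalvedAngleGroup.exists_generators {G : Subgroup SO3} (hG : IsHalvedAngleGroup G) :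
    ∃ A B : SO3, IsOfFinOrder A ∧ A ^ 2 ≠ 1 ∧ (∀ u, IsAxisVector A u → ¬ IsAxisVector B u) ∧
      G = Subgroup.closure {A, B} := by
  obtain ⟨_, C₁, C₂, A, B, θ₁, θ₂, θ₁', θ₂', φ, _, -, rfl, hθ₁, hθ₂, hC₁, hC₂, -, hhalf, hA, hB,
    hφ, rfl⟩ := hG
  have hfin (C : SO3) (hC : C ∈ ({C₁, C₂} : Set SO3)) : IsOfFinOrder C :=
    Submonoid.isOfFinOrder_coe.mpr
      (isOfFinOrder_of_finite (⟨C, Subgroup.subset_closure hC⟩ : Subgroup.closure {C₁, C₂}))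
  have hne {C : SO3} (hC : C ^ 2 ≠ 1) : C ≠ 1 := fun h ↦ hC (by rw [h, one_pow])
  rcases hhalf with ⟨rfl, rfl⟩ | ⟨rfl, rfl⟩
  · have hA2 : A ^ 2 ≠ 1 := hA.sq_ne_one_of_half hC₁ hθ₁
    exact ⟨A, B, hA.isOfFinOrder_of_half hC₁ (hfin C₁ (by simp)), hA2,
      fun u ↦ hφ.not_isAxisVector (hne hA2) (hB.ne_one hθ₂), rfl⟩
  · have hB2 : B ^ 2 ≠ 1 := hB.sq_ne_one_of_half hC₂ hθ₂
    exact ⟨B, A, hB.isOfFinOrder_of_half hC₂ (hfin C₂ (by simp)), hB2,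
      fun u hBu hAu ↦ hφ.not_isAxisVector (hA.ne_one hθ₁) (hne hB2) hAu hBu,
      by rw [Set.pair_comm]⟩

end HalvedAngles

/-! ### Parallel transport in the bundle of 2-vectors -/

section Fibre

theorem det_toBlocks₁₁_eq_det_toBlocks₂₂ {R m n : Type*} [CommRing R] [Fintype m] [Fintype n]
    [DecidableEq m] [DecidableEq n] {Q : Matrix (m ⊕ n) (m ⊕ n) R} (hQ : Q * Qᵀ = 1)
    (hdet : Q.det = 1) : Q.toBlocks₁₁.det = Q.toBlocks₂₂.det := by
  obtain ⟨A, B, C, D, rfl⟩ : ∃ A B C D, Q = Matrix.fromBlocks A B C D :=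
    ⟨_, _, _, _, (Matrix.fromBlocks_toBlocks Q).symm⟩
  rw [Matrix.fromBlocks_transpose, Matrix.fromBlocks_multiply, ← Matrix.fromBlocks_one,
    Matrix.fromBlocks_inj] at hQ
  obtain ⟨hAB, -, hCD, -⟩ := hQ
  have hprod : Matrix.fromBlocks A B C D * Matrix.fromBlocks Aᵀ 0 Bᵀ 1 =
      Matrix.fromBlocks 1 B 0 D := by
    simp [Matrix.fromBlocks_multiply, hAB, hCD]
  simpa [hdet] using congrArg Matrix.det hprod

/-- The 2×2 minor of a matrix on the rows `i`, `j` and the columns `k`, `l`, in this order. -/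
def minor {R m n : Type*} [CommRing R] (Q : Matrix m n R) (i j : m) (k l : n) : R :=
  Q i k * Q j l - Q i l * Q j k

theorem minor_eq_complementary_minor {R : Type*} [CommRing R] {Q : Matrix (Fin 4) (Fin 4) R}
    (hQ : Q * Qᵀ = 1) (hdet : Q.det = 1) (τ : Equiv.Perm (Fin 4)) (hτ : Equiv.Perm.sign τ = 1) :
    minor Q 0 1 (τ 0) (τ 1) = minor Q 2 3 (τ 2) (τ 3) := by
  let f : Fin 2 ⊕ Fin 2 ≃ Fin 4 := finSumFinEquiv
  have hQ' : Q.submatrix f (f.trans τ) * (Q.submatrix f (f.trans τ))ᵀ = 1 := by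
    rw [Matrix.transpose_submatrix, Matrix.submatrix_mul_equiv, hQ, Matrix.submatrix_one_equiv]
  have hdet' : (Q.submatrix f (f.trans τ)).det = 1 := by
    have h : Q.submatrix f (f.trans τ) = (Q.submatrix id τ).submatrix f f := rfl
    rw [h, Matrix.det_submatrix_equiv_self, Matrix.det_permute', hτ, hdet]
    simp
  have h := det_toBlocks₁₁_eq_det_toBlocks₂₂ hQ' hdet'
  rwa [Matrix.det_fin_two, Matrix.det_fin_two] at h

variable {W : Type*} [NormedAddCommGroup W] [InnerProductSpace ℝ W]

theorem wedge_add_left (u u' v : W) : wedge (u + u') v = wedge u v + wedge u' v :=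
  (exteriorPower.ιMulti ℝ 2).map_vecCons_add ![v] u u'

theorem wedge_smul_left (r : ℝ) (u v : W) : wedge (r • u) v = r • wedge u v :=
  (exteriorPower.ιMulti ℝ 2).map_vecCons_smul ![v] r u

theorem wedge_swap (u v : W) : wedge v u = -wedge u v := by
  have := (exteriorPower.ιMulti ℝ 2 (M := W)).map_swap ![u, v] (i := 0) (j := 1) (by simp)
  rw [wedge, wedge, ← this]
  congr 1
  ext i; fin_cases i <;> simp

theorem wedge_self (u : W) : wedge u u = 0 :=
  (exteriorPower.ιMulti ℝ 2 (M := W)).map_eq_zero_of_eq ![u, u] (i := 0) (j := 1) rfl (by simp)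

theorem wedge_add_right (u v v' : W) : wedge u (v + v') = wedge u v + wedge u v' := by
  rw [wedge_swap, wedge_add_left, wedge_swap u v, wedge_swap u v', neg_add, neg_neg, neg_neg]

theorem wedge_smul_right (r : ℝ) (u v : W) : wedge u (r • v) = r • wedge u v := by
  rw [wedge_swap, wedge_smul_left, wedge_swap u v, smul_neg, neg_neg]

theorem wedge_sum_smul {m : Type*} (e : Fin 4 → W) (Q : Matrix m (Fin 4) ℝ) (i j : m) :
    wedge (∑ k, Q i k • e k) (∑ k, Q j k • e k) =
      minor Q i j 0 1 • wedge (e 0) (e 1) + minor Q i j 0 2 • wedge (e 0) (e 2) +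
      minor Q i j 0 3 • wedge (e 0) (e 3) + minor Q i j 2 3 • wedge (e 2) (e 3) +
      minor Q i j 3 1 • wedge (e 3) (e 1) + minor Q i j 1 2 • wedge (e 1) (e 2) := by
  simp only [Fin.sum_univ_four, wedge_add_left, wedge_add_right, wedge_smul_left,
    wedge_smul_right, wedge_self, wedge_swap (e 0) (e 1), wedge_swap (e 0) (e 2),
    wedge_swap (e 0) (e 3), wedge_swap (e 1) (e 2), wedge_swap (e 3) (e 1), wedge_swap (e 2) (e 3),
    minor]
  module

variable {o : Orientation ℝ W (Fin 4)} {ε : ℤˣ}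

theorem wedge_add_smul_wedge_mem_span (e : OrthonormalBasis (Fin 4) ℝ W)
    {Q : Matrix (Fin 4) (Fin 4) ℝ} (hQ : Q * Qᵀ = 1) (hdet : Q.det = 1) :
    wedge (∑ k, Q 0 k • e k) (∑ k, Q 1 k • e k) +
        ε • wedge (∑ k, Q 2 k • e k) (∑ k, Q 3 k • e k) ∈
      Submodule.span ℝ (Set.range (stdTriple ε e)) := by
  -- `c` is the cycle `1 ↦ 2 ↦ 3 ↦ 1`, and `s` exchanges a pair of columns with its complement.
  let c : Equiv.Perm (Fin 4) := Equiv.swap 1 2 * Equiv.swap 2 3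
  let s : Equiv.Perm (Fin 4) := Equiv.swap 0 2 * Equiv.swap 1 3
  have hminor := minor_eq_complementary_minor hQ hdet
  have h01 : minor Q 0 1 0 1 = minor Q 2 3 2 3 := hminor 1 (by decide)
  have h02 : minor Q 0 1 0 2 = minor Q 2 3 3 1 := hminor c (by decide)
  have h03 : minor Q 0 1 0 3 = minor Q 2 3 1 2 := hminor (c * c) (by decide)
  have h23 : minor Q 0 1 2 3 = minor Q 2 3 0 1 := hminor s (by decide)
  have h31 : minor Q 0 1 3 1 = minor Q 2 3 0 2 := hminor (c * s) (by decide)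
  have h12 : minor Q 0 1 1 2 = minor Q 2 3 0 3 := hminor (c * c * s) (by decide)
  have hmem (r : ℝ) (i : Fin 3) :
      r • √2 • stdTriple ε e i ∈ Submodule.span ℝ (Set.range (stdTriple ε e)) :=
    Submodule.smul_mem _ _ (Submodule.smul_mem _ _ (Submodule.subset_span ⟨i, rfl⟩))
  have hr (β : ⋀[ℝ]^2 W) : √2 • (1 / √2 : ℝ) • β = β := by simp [smul_smul]
  convert add_mem (add_mem (hmem (minor Q 0 1 0 1 + ε • minor Q 2 3 0 1) 0)
    (hmem (minor Q 0 1 0 2 + ε • minor Q 2 3 0 2) 1))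
    (hmem (minor Q 0 1 0 3 + ε • minor Q 2 3 0 3) 2) using 1
  simp only [stdTriple, Matrix.cons_val, hr, wedge_sum_smul, h23, h31, h12, ← h01, ← h02, ← h03]
  rcases Int.units_eq_one_or ε with rfl | rfl <;> simp only [one_smul, Units.neg_smul] <;> module

theorem exists_rotation_of_orientation_eq {e e' : OrthonormalBasis (Fin 4) ℝ W}
    (h : e.toBasis.orientation = e'.toBasis.orientation) :
    ∃ Q : Matrix (Fin 4) (Fin 4) ℝ, Q * Qᵀ = 1 ∧ Q.det = 1 ∧ ∀ i, e' i = ∑ k, Q i k • e k := by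
  refine ⟨(e.toBasis.toMatrix e')ᵀ, ?_, ?_, fun i ↦ ?_⟩
  · simpa [Matrix.star_eq_conjTranspose] using
      (Matrix.mem_orthogonalGroup_iff' (Fin 4) ℝ).mp (e.toMatrix_orthonormalBasis_mem_unitary e')
  · rw [Matrix.det_transpose, ← Module.Basis.det_apply,
      e.det_to_matrix_orthonormalBasis_of_same_orientation e' h]
  · simpa using (e.toBasis.sum_toMatrix_smul_self e' i).symm

theorem stdTriple_mem_span {e e' : OrthonormalBasis (Fin 4) ℝ W}
    (h : e.toBasis.orientation = e'.toBasis.orientation) (i : Fin 3) :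
    stdTriple ε e' i ∈ Submodule.span ℝ (Set.range (stdTriple ε e)) := by
  obtain ⟨Q, hQ, hdet, he'⟩ := exists_rotation_of_orientation_eq h
  have key (σ : Equiv.Perm (Fin 4)) (hσ : Equiv.Perm.sign σ = 1) :
      wedge (e' (σ 0)) (e' (σ 1)) + ε • wedge (e' (σ 2)) (e' (σ 3)) ∈
        Submodule.span ℝ (Set.range (stdTriple ε e)) := by
    have hQσ : Q.submatrix σ id * (Q.submatrix σ id)ᵀ = 1 := by
      rw [Matrix.transpose_submatrix, ← Matrix.submatrix_mul _ _ _ _ _ Function.bijective_id, hQ,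
        Matrix.submatrix_one_equiv]
    have hdetσ : (Q.submatrix σ id).det = 1 := by
      rw [Matrix.det_permute, hσ, hdet]
      simp
    simpa only [he', Matrix.submatrix_apply, id_eq] using wedge_add_smul_wedge_mem_span e hQσ hdetσ
  let c : Equiv.Perm (Fin 4) := Equiv.swap 1 2 * Equiv.swap 2 3
  fin_cases i
  · exact Submodule.smul_mem _ _ (key 1 (by decide))
  · exact Submodule.smul_mem _ _ (key c (by decide))
  · exact Submodule.smul_mem _ _ (key (c * c) (by decide))

theorem exists_halfTwoVectors_eq_span_range (o : Orientation ℝ W (Fin 4)) (ε : ℤˣ) :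
    ∃ v : Fin 3 → ⋀[ℝ]^2 W, halfTwoVectors o ε = Submodule.span ℝ (Set.range v) := by
  by_cases hex : ∃ e : OrthonormalBasis (Fin 4) ℝ W, e.toBasis.orientation = o
  · obtain ⟨e, he⟩ := hex
    refine ⟨stdTriple ε e, le_antisymm (Submodule.span_le.mpr ?_) (Submodule.span_mono ?_)⟩
    · rintro _ ⟨e', he', i, rfl⟩
      exact stdTriple_mem_span (he.trans he'.symm) i
    · rintro _ ⟨i, rfl⟩
      exact ⟨e, he, i, rfl⟩
  · refine ⟨0, le_antisymm (Submodule.span_le.mpr ?_) (Submodule.span_le.mpr ?_)⟩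
    · rintro _ ⟨e, he, -⟩
      exact absurd ⟨e, he⟩ hex
    · rintro _ ⟨i, rfl⟩
      exact zero_mem _

theorem eq_sum_hatMetric_smul {α : Fin 3 → ⋀[ℝ]^2 W} (hα : ∀ i, α i ∈ halfTwoVectors o ε)
    (horth : ∀ i j, hatMetric (α i) (α j) = if i = j then 1 else 0) {β : ⋀[ℝ]^2 W}
    (hβ : β ∈ halfTwoVectors o ε) : β = ∑ i, hatMetric β (α i) • α i := by
  have hindep : LinearIndependent ℝ α :=
    LinearMap.linearIndependent_of_isOrthoᵢ (B := hatMetric)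
      (fun i j hij ↦ by simpa [hij] using horth i j) fun i ↦ by simp [horth]
  obtain ⟨v, hv⟩ := exists_halfTwoVectors_eq_span_range o ε
  have hspan : Submodule.span ℝ (Set.range α) = halfTwoVectors o ε := by
    have : FiniteDimensional ℝ (halfTwoVectors o ε) :=
      hv ▸ FiniteDimensional.span_of_finite ℝ (Set.finite_range v)
    refine Submodule.eq_of_le_of_finrank_le (Submodule.span_le.mpr ?_) ?_
    · rintro _ ⟨i, rfl⟩
      exact hα i
    · rw [finrank_span_eq_card hindep, hv]
      exact finrank_range_le_card v
  obtain ⟨c, rfl⟩ := (Submodule.mem_span_range_iff_exists_fun ℝ).mp (hspan ▸ hβ)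
  simp [horth]

end Fibre

section MetricConnection

theorem hasDerivAt_inner_of_isMetricCompatible {EB HB B F : Type*} [NormedAddCommGroup EB]
    [NormedSpace ℝ EB] [TopologicalSpace HB] {I : ModelWithCorners ℝ EB HB} [TopologicalSpace B]
    [ChartedSpace HB B] [NormedAddCommGroup F] [NormedSpace ℝ F] [FiniteDimensional ℝ F]
    {V : B → Type*} [TopologicalSpace (TotalSpace F V)] [∀ x, NormedAddCommGroup (V x)]
    [∀ x, InnerProductSpace ℝ (V x)] [FiberBundle F V] [VectorBundle ℝ F V]
    [ContMDiffVectorBundle 1 F V I] [IsContMDiffRiemannianBundle I 1 F V]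
    {cov : CovariantDerivative I F V} (hcov : cov.IsMetricCompatible) {c : ℝ → B} {t : ℝ}
    (hc : MDifferentiableAt 𝓘(ℝ, ℝ) I c t) {σ τ : ∀ x, V x}
    (hσ : MDifferentiableAt I (I.prod 𝓘(ℝ, F)) (fun x ↦ TotalSpace.mk' F x (σ x)) (c t))
    (hτ : MDifferentiableAt I (I.prod 𝓘(ℝ, F)) (fun x ↦ TotalSpace.mk' F x (τ x)) (c t)) :
    HasDerivAt (fun s ↦ inner ℝ (σ (c s)) (τ (c s)))
      (inner ℝ (cov σ (c t) (mfderiv 𝓘(ℝ, ℝ) I c t (1 : ℝ))) (τ (c t)) +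
        inner ℝ (σ (c t)) (cov τ (c t) (mfderiv 𝓘(ℝ, ℝ) I c t (1 : ℝ)))) t := by
  have hinner : MDifferentiableAt I 𝓘(ℝ, ℝ) (fun x ↦ inner ℝ (σ x) (τ x)) (c t) :=
    hσ.inner_bundle hτ
  let L : ℝ →L[ℝ] ℝ := (mfderiv I 𝓘(ℝ, ℝ) (fun x ↦ inner ℝ (σ x) (τ x)) (c t)).comp
    (mfderiv 𝓘(ℝ, ℝ) I c t)
  have hcomp : HasFDerivAt (fun s ↦ inner ℝ (σ (c s)) (τ (c s))) L t :=
    (hinner.hasMFDerivAt.comp t hc.hasMFDerivAt).hasFDerivAt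
  exact hcomp.hasDerivAt.congr_deriv
    (hcov.mvfderiv_inner_eq (fun _ ↦ mfderiv 𝓘(ℝ, ℝ) I c t (1 : ℝ)) hσ hτ)

variable {E : Torus → Type*} [TopologicalSpace (TotalSpace R4 E)]
  [∀ x, NormedAddCommGroup (E x)] [∀ x, InnerProductSpace ℝ (E x)] [FiberBundle R4 E]
  {cov : CovariantDerivative torusModel R4 E} {c : ℝ → Torus} {s : Set ℝ} {t : ℝ}

section Metric

variable [VectorBundle ℝ R4 E] [ContMDiffVectorBundle 1 R4 E torusModel]
  [IsContMDiffRiemannianBundle torusModel 1 R4 E]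

theorem hasDerivAt_hatMetric_wedge (hcov : cov.IsMetricCompatible)
    (hc : MDifferentiableAt 𝓘(ℝ, ℝ) torusModel c t) {ξ η ξ' η' : ∀ x, E x}
    (hξ : IsSmoothSection ξ) (hη : IsSmoothSection η)
    (hξ' : IsSmoothSection ξ') (hη' : IsSmoothSection η') :
    HasDerivAt (fun τ ↦ hatMetric (wedge (ξ (c τ)) (η (c τ))) (wedge (ξ' (c τ)) (η' (c τ))))
      (hatMetric (wedge (cov ξ (c t) (velocity c t)) (η (c t)) +
          wedge (ξ (c t)) (cov η (c t) (velocity c t))) (wedge (ξ' (c t)) (η' (c t))) +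
        hatMetric (wedge (ξ (c t)) (η (c t))) (wedge (cov ξ' (c t) (velocity c t)) (η' (c t)) +
          wedge (ξ' (c t)) (cov η' (c t) (velocity c t)))) t := by
  have hinner {σ τ : ∀ x, E x} (hσ : IsSmoothSection σ) (hτ : IsSmoothSection τ) :
      HasDerivAt (fun s ↦ inner ℝ (σ (c s)) (τ (c s)))
        (inner ℝ (cov σ (c t) (velocity c t)) (τ (c t)) +
          inner ℝ (σ (c t)) (cov τ (c t) (velocity c t))) t :=
    hasDerivAt_inner_of_isMetricCompatible hcov hc (hσ.mdifferentiableAt (by simp))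
      (hτ.mdifferentiableAt (by simp))
  simp only [map_add, LinearMap.add_apply, hatMetric_wedge]
  refine ((hinner hξ hξ').mul (hinner hη hη')).sub ((hinner hξ hη').mul (hinner hη hξ'))
    |>.congr_deriv ?_
  ring

theorem HasCovDerivWithinAt.hatMetric_wedge (hcov : cov.IsMetricCompatible)
    (hc : MDifferentiableAt 𝓘(ℝ, ℝ) torusModel c t) (ht : t ∈ s)
    {Ω : ∀ t, ⋀[ℝ]^2 (E (c t))} {D : ⋀[ℝ]^2 (E (c t))} (hΩ : HasCovDerivWithinAt cov c Ω s t D)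
    {ξ η : ∀ x, E x} (hξ : IsSmoothSection ξ) (hη : IsSmoothSection η) :
    HasDerivWithinAt (fun τ ↦ hatMetric (Ω τ) (wedge (ξ (c τ)) (η (c τ))))
      (hatMetric D (wedge (ξ (c t)) (η (c t))) +
        hatMetric (Ω t) (wedge (cov ξ (c t) (velocity c t)) (η (c t)) +
          wedge (ξ (c t)) (cov η (c t) (velocity c t)))) s t := by
  obtain ⟨n, f, f', ξ', η', hsmooth, hf, hrep, rfl⟩ := hΩ
  have hsum := HasDerivWithinAt.fun_sum (u := Finset.univ) fun i _ ↦ (hf i).mul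
    (hasDerivAt_hatMetric_wedge hcov hc (hsmooth i).1 (hsmooth i).2 hξ hη).hasDerivWithinAt
  refine (hsum.congr_of_eventuallyEq_of_mem ?_ ht).congr_deriv ?_
  · filter_upwards [hrep] with τ hτ
    simp [hτ]
  · rw [hrep.self_of_nhdsWithin ht]
    simp only [map_sum, LinearMap.sum_apply, map_smul, LinearMap.smul_apply, smul_eq_mul, map_add,
      LinearMap.add_apply, ← Finset.sum_add_distrib]
    exact Finset.sum_congr rfl fun i _ ↦ by ring

theorem HasCovDerivWithinAt.hatMetric (hcov : cov.IsMetricCompatible)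
    (hc : MDifferentiableAt 𝓘(ℝ, ℝ) torusModel c t) (ht : t ∈ s)
    {Ω Ω' : ∀ t, ⋀[ℝ]^2 (E (c t))} {D D' : ⋀[ℝ]^2 (E (c t))}
    (hΩ : HasCovDerivWithinAt cov c Ω s t D) (hΩ' : HasCovDerivWithinAt cov c Ω' s t D') :
    HasDerivWithinAt (fun τ ↦ hatMetric (Ω τ) (Ω' τ))
      (hatMetric D (Ω' t) + hatMetric (Ω t) D') s t := by
  obtain ⟨n, f, f', ξ, η, hsmooth, hf, hrep, rfl⟩ := hΩ'
  have hsum := HasDerivWithinAt.fun_sum (u := Finset.univ) fun i _ ↦ (hf i).mul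
    (hΩ.hatMetric_wedge hcov hc ht (hsmooth i).1 (hsmooth i).2)
  refine (hsum.congr_of_eventuallyEq_of_mem ?_ ht).congr_deriv ?_
  · filter_upwards [hrep] with τ hτ
    simp [hτ]
  · rw [hrep.self_of_nhdsWithin ht]
    simp only [map_sum, map_smul, smul_eq_mul, map_add, ← Finset.sum_add_distrib]
    exact Finset.sum_congr rfl fun i _ ↦ by ring

variable {o : ∀ x, Orientation ℝ (E x) (Fin 4)} {ε : ℤˣ} {t₀ t₁ : ℝ}

theorem IsHorizontalOn.hatMetric_eq (hcov : cov.IsMetricCompatible)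
    (hc : ∀ t, MDifferentiableAt 𝓘(ℝ, ℝ) torusModel c t) (hs : Convex ℝ s)
    {Ω Ω' : ∀ t, ⋀[ℝ]^2 (E (c t))} (hΩ : IsHorizontalOn cov o ε c Ω s)
    (hΩ' : IsHorizontalOn cov o ε c Ω' s) (h₀ : t₀ ∈ s) (h₁ : t₁ ∈ s) :
    hatMetric (Ω t₁) (Ω' t₁) = hatMetric (Ω t₀) (Ω' t₀) := by
  have hderiv : ∀ t ∈ s, HasDerivWithinAt (fun τ ↦ hatMetric (Ω τ) (Ω' τ)) 0 s t := fun t ht ↦ by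
    simpa using (hΩ t ht).2.hatMetric hcov (hc t) ht (hΩ' t ht).2
  have hbound := hs.norm_image_sub_le_of_norm_hasDerivWithin_le (C := 0) hderiv
    (fun _ _ ↦ norm_zero.le) h₀ h₁
  rwa [zero_mul, norm_le_zero_iff, sub_eq_zero] at hbound

theorem IsHorizontalOn.eq_sum_smul (hcov : cov.IsMetricCompatible)
    (hc : ∀ t, MDifferentiableAt 𝓘(ℝ, ℝ) torusModel c t) (hs : Convex ℝ s)
    {F : Fin 3 → ∀ t, ⋀[ℝ]^2 (E (c t))} (hF : ∀ i, IsHorizontalOn cov o ε c (F i) s)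
    {Ω : ∀ t, ⋀[ℝ]^2 (E (c t))} (hΩ : IsHorizontalOn cov o ε c Ω s) (h₀ : t₀ ∈ s) (h₁ : t₁ ∈ s)
    (horth : ∀ i j, hatMetric (F i t₀) (F j t₀) = if i = j then 1 else 0) {b : Fin 3 → ℝ}
    (hb : Ω t₀ = ∑ i, b i • F i t₀) : Ω t₁ = ∑ i, b i • F i t₁ := by
  have horth₁ (i j : Fin 3) : hatMetric (F i t₁) (F j t₁) = if i = j then 1 else 0 :=
    ((hF i).hatMetric_eq hcov hc hs (hF j) h₀ h₁).trans (horth i j)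
  have hcoord (i : Fin 3) : hatMetric (Ω t₁) (F i t₁) = b i := by
    rw [hΩ.hatMetric_eq hcov hc hs (hF i) h₀ h₁, hb]
    simp [horth]
  simpa only [hcoord] using
    eq_sum_hatMetric_smul (fun i ↦ (hF i t₁ h₁).1.1) horth₁ (hΩ t₁ h₁).1.1

end Metric

theorem velocity_comp_const_mul {a : ℝ} (hc : MDifferentiableAt 𝓘(ℝ, ℝ) torusModel c (a * t)) :
    velocity (fun τ ↦ c (a * τ)) t = a • velocity c (a * t) := by
  have hmul : HasDerivAt (fun τ : ℝ ↦ a * τ) a t := by simpa using (hasDerivAt_id t).const_mul a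
  have h := hc.hasMFDerivAt.comp t (f := fun τ : ℝ ↦ a * τ) hmul.hasFDerivAt.hasMFDerivAt
  let L : ℝ →L[ℝ] TangentSpace torusModel (c (a * t)) := mfderiv 𝓘(ℝ, ℝ) torusModel c (a * t)
  calc mfderiv 𝓘(ℝ, ℝ) torusModel (c ∘ fun τ : ℝ ↦ a * τ) t (1 : ℝ)
      = L (ContinuousLinearMap.toSpanSingleton ℝ a 1) := by rw [h.mfderiv]; rfl
    _ = a • L 1 := by rw [← map_smul]; simp

theorem HasCovDerivWithinAt.comp_const_mul {a : ℝ}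
    (hc : MDifferentiableAt 𝓘(ℝ, ℝ) torusModel c (a * t)) {Ω : ∀ t, ⋀[ℝ]^2 (E (c t))}
    {D : ⋀[ℝ]^2 (E (c (a * t)))} (hΩ : HasCovDerivWithinAt cov c Ω univ (a * t) D) (s : Set ℝ) :
    HasCovDerivWithinAt cov (fun τ ↦ c (a * τ)) (fun τ ↦ Ω (a * τ)) s t (a • D) := by
  obtain ⟨n, f, f', ξ, η, hsmooth, hf, hrep, rfl⟩ := hΩ
  have hmul : HasDerivAt (fun τ : ℝ ↦ a * τ) a t := by simpa using (hasDerivAt_id t).const_mul a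
  refine ⟨n, fun i τ ↦ f i (a * τ), fun i ↦ a * f' i, ξ, η, hsmooth, fun i ↦ ?_, ?_, ?_⟩
  · simpa [mul_comm] using! (((hf i).hasDerivAt univ_mem).comp t hmul).hasDerivWithinAt
  · rw [nhdsWithin_univ] at hrep
    exact (hmul.continuousAt.eventually hrep).filter_mono nhdsWithin_le_nhds
  · rw [Finset.smul_sum, velocity_comp_const_mul hc]
    refine Finset.sum_congr rfl fun i _ ↦ ?_
    rw [map_smul, map_smul, wedge_smul_left, wedge_smul_right]
    module

theorem IsHorizontalOn.comp_const_mul {o : ∀ x, Orientation ℝ (E x) (Fin 4)} {ε : ℤˣ}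
    (hc : ∀ t, MDifferentiableAt 𝓘(ℝ, ℝ) torusModel c t) {Ω : ∀ t, ⋀[ℝ]^2 (E (c t))}
    (hΩ : IsHorizontalOn cov o ε c Ω univ) (a : ℝ) (s : Set ℝ) :
    IsHorizontalOn cov o ε (fun τ ↦ c (a * τ)) (fun τ ↦ Ω (a * τ)) s := fun t _ ↦
  ⟨(hΩ (a * t) (mem_univ _)).1, by
    simpa only [smul_zero] using (hΩ (a * t) (mem_univ _)).2.comp_const_mul (hc _) s⟩

end MetricConnection

section Transport

theorem mdifferentiableAt_pr_comp {f g : ℝ → ℝ} (hf : ContDiff ℝ 1 f) (hg : ContDiff ℝ 1 g)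
    (t : ℝ) : MDifferentiableAt 𝓘(ℝ, ℝ) torusModel (fun t ↦ pr (f t, g t)) t :=
  ((contMDiff_circleExp.comp hf.contMDiff).prodMk
    (contMDiff_circleExp.comp hg.contMDiff)).mdifferentiableAt one_ne_zero

theorem mdifferentiableAt_lineX (t : ℝ) : MDifferentiableAt 𝓘(ℝ, ℝ) torusModel lineX t :=
  mdifferentiableAt_pr_comp contDiff_id contDiff_const t

theorem mdifferentiableAt_lineY (t : ℝ) : MDifferentiableAt 𝓘(ℝ, ℝ) torusModel lineY t :=
  mdifferentiableAt_pr_comp contDiff_const contDiff_id t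

theorem segmentCurve_eq_pr_smul {v : ℝ × ℝ} (hv : pr v = pr (0, 0)) (w : ℝ × ℝ) (t : ℝ) :
    segmentCurve v w t = pr (t • (w - v)) := by
  simp_all [segmentCurve, pr, Circle.exp_add]

theorem exists_segmentCurve_eq_lineX {v w : ℝ × ℝ} (hv : pr v = pr (0, 0)) (hw : pr v = pr w)
    (h : v.2 = w.2) : ∃ m : ℤ, segmentCurve v w = fun t ↦ lineX (2 * Real.pi * m * t) := by
  obtain ⟨m, hm⟩ := Circle.exp_eq_exp.mp (congrArg Prod.fst hw).symm
  refine ⟨m, funext fun t ↦ (segmentCurve_eq_pr_smul hv w t).trans (congrArg pr ?_)⟩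
  ext
  · simp [hm]; ring
  · simp [h]

theorem exists_segmentCurve_eq_lineY {v w : ℝ × ℝ} (hv : pr v = pr (0, 0)) (hw : pr v = pr w)
    (h : v.1 = w.1) : ∃ m : ℤ, segmentCurve v w = fun t ↦ lineY (2 * Real.pi * m * t) := by
  obtain ⟨m, hm⟩ := Circle.exp_eq_exp.mp (congrArg Prod.snd hw).symm
  refine ⟨m, funext fun t ↦ (segmentCurve_eq_pr_smul hv w t).trans (congrArg pr ?_)⟩
  ext
  · simp [h]
  · simp [hm]; ring

variable {E : Torus → Type*} [∀ x, NormedAddCommGroup (E x)] [∀ x, InnerProductSpace ℝ (E x)]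

/-- The 2-vector with coordinates `b` in the frame `α` at `x`, as a point of the total space of
`⋀² E`. Equalities between points over base points which agree only propositionally are stated
in the total space. -/
def ofCoords {x : Torus} (α : Fin 3 → ⋀[ℝ]^2 (E x)) (b : EuclideanSpace ℝ (Fin 3)) :
    Σ x, ⋀[ℝ]^2 (E x) :=
  ⟨x, ∑ i, b i • α i⟩

theorem mk_eq_ofCoords_iff {x : Torus} {α : Fin 3 → ⋀[ℝ]^2 (E x)}
    {b : EuclideanSpace ℝ (Fin 3)} {β : ⋀[ℝ]^2 (E x)} :
    (⟨x, β⟩ : Σ x, ⋀[ℝ]^2 (E x)) = ofCoords α b ↔ β = ∑ i, b i • α i := by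
  simp [ofCoords]

theorem ofCoords_eq_ofCoords_smul {x y : Torus} {α : Fin 3 → ⋀[ℝ]^2 (E x)}
    {β : Fin 3 → ⋀[ℝ]^2 (E y)} {C : SO3} (h : ∀ i, (⟨x, α i⟩ : Σ x, ⋀[ℝ]^2 (E x)) =
      ⟨y, ∑ j, (C : Matrix (Fin 3) (Fin 3) ℝ) j i • β j⟩) (b : EuclideanSpace ℝ (Fin 3)) :
    ofCoords α b = ofCoords β (C • b) := by
  obtain rfl : x = y := congrArg Sigma.fst (h 0)
  refine mk_eq_ofCoords_iff.mpr ?_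
  simp only [fun i ↦ sigma_mk_injective (h i), SO3.ofLp_smul, Matrix.mulVec, dotProduct,
    Finset.smul_sum, Finset.sum_smul, smul_smul]
  rw [Finset.sum_comm]
  simp only [mul_comm]

theorem IsMonodromyMatrix.ofCoords_zpow {c : ℝ → Torus} {F : Fin 3 → ∀ t, ⋀[ℝ]^2 (E (c t))}
    {C : SO3} (hC : IsMonodromyMatrix c F C) (m : ℤ) (b : EuclideanSpace ℝ (Fin 3)) :
    ofCoords (fun i ↦ F i (2 * Real.pi * m)) b = ofCoords (fun i ↦ F i 0) (C ^ m • b) := by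
  have hturn (k : ℤ) (b : EuclideanSpace ℝ (Fin 3)) :
      ofCoords (fun i ↦ F i (2 * Real.pi * (k + 1 : ℤ))) b =
        ofCoords (fun i ↦ F i (2 * Real.pi * k)) (C • b) := by
    rw [show 2 * Real.pi * (k + 1 : ℤ) = 2 * Real.pi * k + 2 * Real.pi by push_cast; ring]
    exact ofCoords_eq_ofCoords_smul (hC _) b
  induction m generalizing b with
  | zero => rw [zpow_zero, one_smul, Int.cast_zero, mul_zero]
  | succ k ih => rw [hturn, ih, smul_smul, zpow_add_one]
  | pred k ih =>
    calc ofCoords (fun i ↦ F i (2 * Real.pi * (-k - 1 : ℤ))) b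
        = ofCoords (fun i ↦ F i (2 * Real.pi * (-k - 1 : ℤ))) (C • C⁻¹ • b) := by
          rw [smul_inv_smul]
      _ = ofCoords (fun i ↦ F i 0) (C ^ (-k - 1 : ℤ) • b) := by
          rw [← hturn, sub_add_cancel, ih, smul_smul, zpow_sub_one]

variable [TopologicalSpace (TotalSpace R4 E)] [FiberBundle R4 E]
  {cov : CovariantDerivative torusModel R4 E} {o : ∀ x, Orientation ℝ (E x) (Fin 4)} {ε : ℤˣ}

theorem IsTopologicalHolonomyGroup.fg {H : Subgroup SO3}
    (hH : IsTopologicalHolonomyGroup cov o ε H) : Group.FG H := by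
  obtain ⟨-, -, -, C₁, C₂, -, -, -, -, -, rfl⟩ := hH
  exact Group.closure_finite_fg _

variable [VectorBundle ℝ R4 E] [ContMDiffVectorBundle 1 R4 E torusModel]
  [IsContMDiffRiemannianBundle torusModel 1 R4 E]

theorem IsMonodromyMatrix.transport_eq {c : ℝ → Torus} {F : Fin 3 → ∀ t, ⋀[ℝ]^2 (E (c t))}
    {C : SO3} (hC : IsMonodromyMatrix c F C) (hcov : cov.IsMetricCompatible)
    (hc : ∀ t, MDifferentiableAt 𝓘(ℝ, ℝ) torusModel c t)
    {α : Fin 3 → ⋀[ℝ]^2 (E (c 0))} (hF : ∀ i, IsHorizontalOn cov o ε c (F i) univ ∧ F i 0 = α i)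
    (horth : ∀ i j, hatMetric (α i) (α j) = if i = j then 1 else 0) {m : ℤ} {d : ℝ → Torus}
    (hd : d = fun t ↦ c (2 * Real.pi * m * t)) {Ω : ∀ t, ⋀[ℝ]^2 (E (d t))}
    (hΩ : IsHorizontalOn cov o ε d Ω (Icc 0 1)) {b : EuclideanSpace ℝ (Fin 3)}
    (hb : ⟨d 0, Ω 0⟩ = ofCoords α b) : ⟨d 1, Ω 1⟩ = ofCoords α (C ^ m • b) := by
  subst hd
  obtain rfl : (fun i ↦ F i 0) = α := funext fun i ↦ (hF i).2
  have ofCoords_congr {t t' : ℝ} (h : t = t') :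
      ofCoords (fun i ↦ F i t) b = ofCoords (fun i ↦ F i t') b := by rw [h]
  have hdiff (t : ℝ) : MDifferentiableAt 𝓘(ℝ, ℝ) torusModel
      (fun t ↦ c (2 * Real.pi * m * t)) t :=
    (hc _).comp t (by fun_prop : DifferentiableAt ℝ _ t).mdifferentiableAt
  have hstart : Ω 0 = ∑ i, b i • F i (2 * Real.pi * m * 0) :=
    mk_eq_ofCoords_iff.mp (hb.trans (ofCoords_congr (mul_zero _).symm))
  have hend : Ω 1 = ∑ i, b i • F i (2 * Real.pi * m * 1) :=
    hΩ.eq_sum_smul hcov hdiff (convex_Icc 0 1)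
      (fun i ↦ (hF i).1.comp_const_mul hc (2 * Real.pi * m) (Icc 0 1)) (by simp) (by simp)
      (by rw [mul_zero]; exact horth) hstart
  exact ((mk_eq_ofCoords_iff.mpr hend).trans (ofCoords_congr (mul_one _))).trans
    (hC.ofCoords_zpow m b)

theorem IsTopologicalHolonomyGroup.exists_frame {H : Subgroup SO3}
    (hH : IsTopologicalHolonomyGroup cov o ε H) (hcov : cov.IsMetricCompatible) :
    ∃ α : Fin 3 → ⋀[ℝ]^2 (E (pr (0, 0))),
      (∀ i, α i ∈ halfTwoVectors (o (pr (0, 0))) ε) ∧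
      (∀ i j, hatMetric (α i) (α j) = if i = j then 1 else 0) ∧
      ∀ v w b q, pr v = pr (0, 0) → pr v = pr w → (v.1 = w.1 ∨ v.2 = w.2) →
        SegmentTransport cov o ε v w (ofCoords α b) q → ∃ g ∈ H, q = ofCoords α (g • b) := by
  obtain ⟨α, Ωx, Ωy, C₁, C₂, hα, hx, hy, hC₁, hC₂, rfl⟩ := hH
  refine ⟨α, fun i ↦ (hx i).2 ▸ ((hx i).1 0 (mem_univ _)).1.1, hα.1, ?_⟩
  rintro v w b _ hv hvw hcoord ⟨Ω, hΩ, hp, rfl⟩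
  rcases hcoord with h | h
  · obtain ⟨m, hm⟩ := exists_segmentCurve_eq_lineY hv hvw h
    exact ⟨C₂ ^ m, zpow_mem (Subgroup.subset_closure (by simp)) m,
      hC₂.transport_eq hcov mdifferentiableAt_lineY hy hα.1 hm hΩ hp.symm⟩
  · obtain ⟨m, hm⟩ := exists_segmentCurve_eq_lineX hv hvw h
    exact ⟨C₁ ^ m, zpow_mem (Subgroup.subset_closure (by simp)) m,
      hC₁.transport_eq hcov mdifferentiableAt_lineX hx hα.1 hm hΩ hp.symm⟩

theorem IsTopologicalHolonomyGroup.infinite {H : Subgroup SO3}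
    (hH : IsTopologicalHolonomyGroup cov o ε H) (hcov : cov.IsMetricCompatible)
    (hinf : HasInfiniteComplexity cov o ε) : Infinite H := by
  obtain ⟨α, hα, horth, hseg⟩ := hH.exists_frame hcov
  obtain ⟨β, hβ, hinf⟩ := hinf
  let b : EuclideanSpace ℝ (Fin 3) := WithLp.toLp 2 fun i ↦ hatMetric β (α i)
  have hb : ⟨pr (0, 0), β⟩ = ofCoords α b :=
    mk_eq_ofCoords_iff.mpr (eq_sum_hatMetric_smul hα horth hβ.1)
  have hsub : transportSet cov o ε β ⊆ range fun g : H ↦ ∑ i, ((g : SO3) • b) i • α i := by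
    rintro β' ⟨γ, τ, hτ₀, hτ₁, hτ⟩
    have hvertex (i : Fin (γ.length + 1)) :
        pr (γ.vertex i) = pr (0, 0) ∧ ∃ g ∈ H, τ i = ofCoords α (g • b) := by
      induction i using Fin.induction with
      | zero => exact ⟨by rw [γ.start], 1, one_mem H, by rw [hτ₀, hb, one_smul]⟩
      | succ i ih =>
        obtain ⟨hv, g, hg, hτi⟩ := ih
        obtain ⟨k, hk, hτk⟩ := hseg _ _ _ _ hv (γ.closed i) (γ.coord i) (hτi ▸ hτ i)
        exact ⟨(γ.closed i).symm.trans hv, k * g, mul_mem hk hg, by rw [hτk, smul_smul]⟩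
    obtain ⟨-, g, hg, h⟩ := hvertex (Fin.last _)
    exact ⟨⟨g, hg⟩, (mk_eq_ofCoords_iff.mp (hτ₁.symm.trans h)).symm⟩
  refine not_finite_iff_infinite.mp fun _ ↦ hinf ((finite_range _).subset hsub)

end Transport

end TopHolonomy

end

theorem proposition3p4_general {E : TopHolonomy.Torus → Type*}
    [TopologicalSpace (TotalSpace TopHolonomy.R4 E)]
    [∀ x, NormedAddCommGroup (E x)] [∀ x, InnerProductSpace ℝ (E x)]
    [FiberBundle TopHolonomy.R4 E] [VectorBundle ℝ TopHolonomy.R4 E]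
    [ContMDiffVectorBundle ∞ TopHolonomy.R4 E TopHolonomy.torusModel]
    [IsContMDiffRiemannianBundle TopHolonomy.torusModel ∞ TopHolonomy.R4 E]
    (o : ∀ x, Orientation ℝ (E x) (Fin 4))
    (cov : CovariantDerivative TopHolonomy.torusModel TopHolonomy.R4 E)
    (hcov : cov.IsMetricCompatible)
    (ε : ℤˣ)
    (H : Subgroup TopHolonomy.SO3) (hH : TopHolonomy.IsTopologicalHolonomyGroup cov o ε H)
    {A B : TopHolonomy.SO3} (hA : IsOfFinOrder A) (hA2 : A ^ 2 ≠ 1)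
    (hAB : ∀ u, TopHolonomy.IsAxisVector A u → ¬ TopHolonomy.IsAxisVector B u)
    (hiso : Nonempty (H ≃* Subgroup.closure {A, B}))
    (hinf : TopHolonomy.HasInfiniteComplexity cov o ε) :
    ∃ C : Fin 2 → TopHolonomy.SO3, (∀ k, C k ∈ H) ∧
      TopHolonomy.ConditionA C ∧ TopHolonomy.ConditionB C ∧ TopHolonomy.ConditionC C := by
  obtain ⟨f⟩ := hiso
  have := hH.infinite hcov hinf
  have := hH.fg
  exact TopHolonomy.exists_conditions_of_mulEquiv hA hA2 hAB f

theorem proposition3p4 {E : TopHolonomy.Torus → Type*}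
    [TopologicalSpace (TotalSpace TopHolonomy.R4 E)]
    [∀ x, NormedAddCommGroup (E x)] [∀ x, InnerProductSpace ℝ (E x)]
    [FiberBundle TopHolonomy.R4 E] [VectorBundle ℝ TopHolonomy.R4 E]
    [ContMDiffVectorBundle ∞ TopHolonomy.R4 E TopHolonomy.torusModel]
    [IsContMDiffRiemannianBundle TopHolonomy.torusModel ∞ TopHolonomy.R4 E]
    (o : ∀ x, Orientation ℝ (E x) (Fin 4)) (ho : TopHolonomy.IsBundleOrientation o)
    (cov : CovariantDerivative TopHolonomy.torusModel TopHolonomy.R4 E)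
    (hsmooth : CovariantDerivative.ContMDiffCovariantDerivative cov ∞)
    (hcov : cov.IsMetricCompatible)
    (ε : ℤˣ)
    (H : Subgroup TopHolonomy.SO3) (hH : TopHolonomy.IsTopologicalHolonomyGroup cov o ε H)
    (G : Subgroup TopHolonomy.SO3) (hG : TopHolonomy.IsHalvedAngleGroup G)
    (hiso : Nonempty (H ≃* G))
    (hinf : TopHolonomy.HasInfiniteComplexity cov o ε) :
    ∃ C : Fin 2 → TopHolonomy.SO3, (∀ k, C k ∈ H) ∧
      TopHolonomy.ConditionA C ∧ TopHolonomy.ConditionB C ∧ TopHolonomy.ConditionC C := by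
  obtain ⟨A, B, hA, hA2, hAB, rfl⟩ := hG.exists_generators
  exact proposition3p4_general o cov hcov ε H hH hA hA2 hAB hiso hinf
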